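/- Let $\gamma$ be a nonnegative random variable whose moment generating function has the posynomial form $$\mathbb E[e^{s\gamma}]=\sum_{k=1}^K c_k\prod_{i=1}^{n_k}\Bigl(1-\frac{s}{a_{k,i}}\Bigr)^{-b_{k,i}}\qquad(\operatorname{Re}s\le 0),$$ where the complex parameters satisfy $\operatorname{Re}a_{k,i}>0$ for all $k,i$, $B_k:=\sum_{i=1}^{n_k}b_{k,i}$ is real and positive for all $k$, and $\sum_{k=1}^K c_k=1$. (All powers are principal.) Then: (i) For every $x\ge 0$, the cumulative distribution function of $\gamma$ is $$F_\gamma(x)=\sum_{k=1}^K c_k\,\frac{\prod_{i=1}^{n_k}a_{k,i}^{\,b_{k,i}}}{\Gamma(1+B_k)}\,x^{B_k}\,\Phi_2^{(n_k)}\bigl(b_{k,1},\dots,b_{k,n_k};1+B_k;-a_{k,1}x,\dots,-a_{k,n_k}x\bigr).$$ (ii) For every $p>0$, with $Q(y)=\frac1{\sqrt{2\pi}}\int_y^\infty e^{-t^2/2}\,dt$, the Gaussian $Q$-transform of $\gamma$ is $$\mathbb E\bigl[Q(\sqrt{p\gamma})\bigr]=\frac1{2\sqrt\pi}\sum_{k=1}^K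 c_k\Bigl(\prod_{i=1}^{n_k}a_{k,i}^{\,b_{k,i}}\Bigr)\frac{\Gamma(\frac12+B_k)}{\Gamma(1+B_k)}\Bigl(\frac2p\Bigr)^{B_k}F_D^{(n_k)}\Bigl(\tfrac12+B_k,b_{k,1},\dots,b_{k,n_k};1+B_k;-\tfrac{2a_{k,1}}p,\dots,-\tfrac{2a_{k,n_k}}p\Bigr).$$ Here, with $(z)_m=z(z+1)\cdots(z+m-1)$ and $|m|=m_1+\dots+m_n$, $$\Phi_2^{(n)}(b_1,\dots,b_n;c;x_1,\dots,x_n)=\sum_{m\in\mathbb N^n}\frac{\prod_i(b_i)_{m_i}}{(c)_{|m|}}\prod_i\frac{x_i^{m_i}}{m_i!},$$ and $F_D^{(n)}(a,b_1,\dots,b_n;c;\cdot)$ is the holomorphic function on $(\mathbb C\setminus[1,\infty))^n$ that on the polydisc $\max_i|x_i|<1$ is given by $$F_D^{(n)}(a,b_1,\dots,b_n;c;x_1,\dots,x_n)=\sum_{m\in\mathbb N^n}\frac{(a)_{|m|}\prod_i(b_i)_{m_i}}{(c)_{|m|}}\prod_i\frac{x_i^{m_i}}{m_i!}.$$ -/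

import Mathlib

open MeasureTheory ProbabilityTheory

noncomputable section

/-- The (rising) Pochhammer symbol `(z)_m = z (z + 1) ⋯ (z + m - 1)` of a complex number. -/
def poch (z : ℂ) (m : ℕ) : ℂ := (ascPochhammer ℂ m).eval z

/-- The confluent Lauricella function of `n` variables
`Φ₂⁽ⁿ⁾(b₁, …, bₙ; c; x₁, …, xₙ) = ∑_m ∏ᵢ (bᵢ)_{mᵢ} / (c)_{m₁ + ⋯ + mₙ} · ∏ᵢ xᵢ ^ mᵢ / mᵢ!`,
the sum being over all multi-indices `m ∈ ℕⁿ`; the series converges absolutely everywhere. -/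
def lauricellaPhi2 {n : ℕ} (b : Fin n → ℂ) (c : ℂ) (x : Fin n → ℂ) : ℂ :=
  ∑' m : Fin n → ℕ,
    (∏ i, poch (b i) (m i)) / poch c (∑ i, m i) * ∏ i, x i ^ m i / ((m i).factorial : ℂ)

/-- The term of index `m ∈ ℕⁿ` of the series of the Lauricella function `F_D⁽ⁿ⁾`:
`(a)_{|m|} ∏ᵢ (bᵢ)_{mᵢ} / (c)_{|m|} · ∏ᵢ xᵢ ^ mᵢ / mᵢ!`, with `|m| = m₁ + ⋯ + mₙ`. -/
def lauricellaFDTerm {n : ℕ} (a : ℂ) (b : Fin n → ℂ) (c : ℂ) (x : Fin n → ℂ)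
    (m : Fin n → ℕ) : ℂ :=
  poch a (∑ i, m i) * (∏ i, poch (b i) (m i)) / poch c (∑ i, m i) *
    ∏ i, x i ^ m i / ((m i).factorial : ℂ)

/-- The domain `(ℂ \ [1, ∞))ⁿ` of the principal branch of `F_D⁽ⁿ⁾`. -/
def lauricellaDomain (n : ℕ) : Set (Fin n → ℂ) :=
  {x | ∀ i, 1 - x i ∈ Complex.slitPlane}

/-- `F` is the principal branch of `F_D⁽ⁿ⁾(a, b₁, …, bₙ; c; ·)`: it is holomorphic on
`(ℂ \ [1, ∞))ⁿ`, and on the open unit polydisc it is the sum of the Lauricella series. -/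
structure IsLauricellaFD {n : ℕ} (a : ℂ) (b : Fin n → ℂ) (c : ℂ) (F : (Fin n → ℂ) → ℂ) :
    Prop where
  differentiableOn : DifferentiableOn ℂ F (lauricellaDomain n)
  hasSum : ∀ x : Fin n → ℂ, (∀ i, ‖x i‖ < 1) → HasSum (lauricellaFDTerm a b c x) (F x)

/-- The principal branch is unique on `(ℂ \ [1, ∞))ⁿ`. -/
theorem IsLauricellaFD.eqOn {n : ℕ} {a : ℂ} {b : Fin n → ℂ} {c : ℂ} {F G : (Fin n → ℂ) → ℂ}
    (hF : IsLauricellaFD a b c F) (hG : IsLauricellaFD a b c G) :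
    Set.EqOn F G (lauricellaDomain n) := by
  intro x hx
  have hopen : IsOpen (lauricellaDomain n) := by
    have h : lauricellaDomain n = ⋂ i, {y : Fin n → ℂ | 1 - y i ∈ Complex.slitPlane} := by
      ext y; simp [lauricellaDomain]
    rw [h]
    exact isOpen_iInter_of_finite fun i =>
      Complex.isOpen_slitPlane.preimage (by fun_prop : Continuous fun y : Fin n → ℂ => 1 - y i)
  let U : Set ℂ := (fun t : ℂ => t • x) ⁻¹' lauricellaDomain n
  have hcont : Continuous fun t : ℂ => t • x := by fun_prop
  have hU : IsOpen U := hopen.preimage hcont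
  have h0 : (0 : ℂ) ∈ U := by
    intro i
    simp [Complex.mem_slitPlane_iff]
  have hstar : StarConvex ℝ 0 U := by
    rw [starConvex_zero_iff]
    intro t ht s hs0 hs1 i
    have hi := ht i
    simp only [Pi.smul_apply, smul_eq_mul, Complex.mem_slitPlane_iff, Complex.sub_re,
      Complex.sub_im, Complex.one_re, Complex.one_im, Complex.real_smul, mul_assoc,
      Complex.re_ofReal_mul, Complex.im_ofReal_mul] at hi ⊢
    rcases hs0.eq_or_lt with rfl | hs
    · left; simp
    · rcases hi with hi | hi
      · left
        nlinarith
      · right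
        intro h
        apply hi
        have h' : s * (t * x i).im = 0 := by linarith
        have := (mul_eq_zero.mp h').resolve_left hs.ne'
        linarith
  have hpre : IsPreconnected U :=
    (hstar.isPathConnected h0).isConnected.isPreconnected
  have hd : ∀ H : (Fin n → ℂ) → ℂ, DifferentiableOn ℂ H (lauricellaDomain n) →
      AnalyticOnNhd ℂ (fun t : ℂ => H (t • x)) U := fun H hH =>
    (hH.comp (by fun_prop : DifferentiableOn ℂ (fun t : ℂ => t • x) U)
      (fun _ ht => ht)).analyticOnNhd hU
  have hev : (fun t : ℂ => F (t • x)) =ᶠ[nhds 0] fun t : ℂ => G (t • x) := by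
    have hnear : ∀ᶠ t : ℂ in nhds 0, ∀ i, ‖(t • x) i‖ < 1 := by
      rw [Filter.eventually_all]
      intro i
      have hc : Continuous fun t : ℂ => ‖(t • x) i‖ := by
        simp only [Pi.smul_apply]; fun_prop
      exact hc.continuousAt.eventually_lt continuousAt_const (by simp)
    filter_upwards [hnear] with t ht
    exact (hF.hasSum _ ht).unique (hG.hasSum _ ht)
  have h1 : (1 : ℂ) ∈ U := by
    change (1 : ℂ) • x ∈ lauricellaDomain n
    simpa using hx
  simpa using (hd F hF.differentiableOn).eqOn_of_preconnected_of_eventuallyEq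
    (hd G hG.differentiableOn) hpre h0 hev h1

open Classical in
/-- The Lauricella function `F_D⁽ⁿ⁾(a, b₁, …, bₙ; c; x₁, …, xₙ)`: the sum of its series for
`|xᵢ| < 1`, continued analytically to `(ℂ \ [1, ∞))ⁿ`. -/
def lauricellaFD {n : ℕ} (a : ℂ) (b : Fin n → ℂ) (c : ℂ) (x : Fin n → ℂ) : ℂ :=
  if h : ∃ F : (Fin n → ℂ) → ℂ, IsLauricellaFD a b c F then h.choose x else 0

/-- The Gaussian `Q`-function `Q(x) = (2π)^{-1/2} ∫_x^∞ exp(-t² / 2) dt`. -/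
def gaussianQ (x : ℝ) : ℝ :=
  (√(2 * Real.pi))⁻¹ * ∫ t in Set.Ioi x, Real.exp (-t ^ 2 / 2)

/-- The Gaussian `Q`-transform `p ↦ E[Q(√(p γ))]` of a nonnegative random variable `γ`. -/
def gaussianQTransform {Ω : Type*} [MeasurableSpace Ω] (γ : Ω → ℝ) (P : Measure Ω) (p : ℝ) : ℝ :=
  ∫ ω, gaussianQ (√(p * γ ω)) ∂P

/-- The nonnegative random variable `γ` is posynomial with characteristic coefficients
`a k i`, `b k i`, `c k`. The moment generating function `s ↦ E[exp(s γ)]` is considered on the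
closed left half-plane, where it exists for every nonnegative random variable; powers are
principal. -/
structure IsPosynomial {Ω : Type*} [MeasurableSpace Ω] (γ : Ω → ℝ) (P : Measure Ω)
    {K : ℕ} {n : Fin K → ℕ} (a b : (k : Fin K) → Fin (n k) → ℂ) (c : Fin K → ℂ) : Prop where
  /-- `γ` is nonnegative. -/
  nonneg : ∀ᵐ ω ∂P, 0 ≤ γ ω
  /-- First compatibility condition. -/
  re_pos : ∀ k i, 0 < (a k i).re
  /-- Second compatibility condition: each sum `∑ᵢ b k i` is real and positive. -/
  sum_pos : ∀ k, 0 < (∑ i, b k i).re ∧ (∑ i, b k i).im = 0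
  /-- Third compatibility condition. -/
  sum_eq_one : ∑ k, c k = 1
  /-- The form of the moment generating function. -/
  mgf_eq : ∀ s : ℂ, s.re ≤ 0 →
    complexMGF γ P s = ∑ k, c k * ∏ i, (1 - s / a k i) ^ (-b k i)

end

/-! Both formulas are read off from the moment generating function on the negative real axis. For t
> 0 each factor splits as (1 + t/a)^(-b) = a^b t^(-b) (1 + a/t)^(-b) (`one_add_div_cpow`): the
principal logarithms are additive here because a, t and a + t all lie in the open right half-plane.
With B = ∑ b_i, a summand at s = -t is thus c ∏ a_i^(b_i) · t^(-B) · ∏ (1 + a_i/t)^(-b_i).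

Distribution function: for t larger than every |a_i|, divide by t and expand the last product in
binomial series. Each t^(-B-|m|-1) is the Laplace transform of x^(B+|m|)/Γ(1+B+|m|), and the terms
add up to x^B Φ₂ (`laplace_lauricellaPhi2`). On the other hand E[e^(-tγ)]/t is the Laplace transform
of the distribution function (`laplace_cdf`). Uniqueness of Laplace transforms
(`eq_zero_of_laplace_eq_zero`) gives equality at the continuity points in (0, ∞), and right
continuity extends it to [0, ∞) (`eq_of_eq_continuousAt`).

Q-transform: Craig's formula (`gaussianQ_sqrt_eq`) expresses Q(√(pγ)) through e^(-pγ/(2t)),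
integrated over 0 < t < 1 against t^(-1/2) (1-t)^(-1/2), so by Fubini only the moment generating
function at s = -p/(2t) matters. The splitting turns each summand into t^(B-1/2) (1-t)^(-1/2) ∏ (1 -
t x_i)^(-b_i) with x_i = -2a_i/p, which is Euler's integrand for F_D. Euler's integral is
holomorphic on the whole domain and has the right series, so it is the principal branch
(`lauricellaFD_eq_lauricellaEuler`). -/

/-! ### Pochhammer symbols -/

lemma poch_succ (z : ℂ) (m : ℕ) : poch z (m + 1) = poch z m * (z + m) := by
  simp [poch, ascPochhammer_succ_eval]

lemma poch_zero (z : ℂ) : poch z 0 = 1 := by simp [poch]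

/-- Crude bound for the numerators of Φ₂; each factor satisfies |z + j| ≤ (1 + |z|)(j + 1). -/
lemma norm_poch_le (z : ℂ) (m : ℕ) : ‖poch z m‖ ≤ (1 + ‖z‖) ^ m * m.factorial := by
  induction m with
  | zero => simp [poch_zero]
  | succ m ih =>
    rw [poch_succ, norm_mul, pow_succ, Nat.factorial_succ]
    have h : ‖z + m‖ ≤ (1 + ‖z‖) * (m + 1 : ℝ) := by
      refine (norm_add_le _ _).trans ?_
      rw [Complex.norm_natCast]
      nlinarith [norm_nonneg z, mul_nonneg (norm_nonneg z) (Nat.cast_nonneg (α := ℝ) m)]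
    calc _ ≤ ((1 + ‖z‖) ^ m * m.factorial) * ((1 + ‖z‖) * (m + 1 : ℝ)) := by gcongr
      _ = _ := by push_cast; ring

lemma factorial_le_norm_poch {z : ℂ} (hz : 1 ≤ z.re) (m : ℕ) :
    (m.factorial : ℝ) ≤ ‖poch z m‖ := by
  induction m with
  | zero => simp [poch_zero]
  | succ m ih =>
    rw [poch_succ, norm_mul, Nat.factorial_succ, Nat.cast_mul, mul_comm]
    have h : ((m + 1 : ℕ) : ℝ) ≤ ‖z + m‖ := by
      refine le_trans ?_ (Complex.re_le_norm _)
      simp; linarith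
    gcongr

lemma Gamma_add_natCast_eq {z : ℂ} (hz : 0 < z.re) (m : ℕ) :
    Complex.Gamma (z + m) = poch z m * Complex.Gamma z := by
  rw [poch, ← Complex.Gamma_add_nat_div_Gamma_eq, div_mul_cancel₀]
  · exact Complex.Gamma_ne_zero_of_re_pos hz
  · intro k hk
    have : (0 : ℝ) ≤ k := k.cast_nonneg
    rw [hk] at hz
    simp at hz
    linarith

lemma poch_ne_zero {z : ℂ} (hz : 0 < z.re) (m : ℕ) : poch z m ≠ 0 := by
  intro h
  have := Gamma_add_natCast_eq hz m
  rw [h, zero_mul] at this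
  refine Complex.Gamma_ne_zero_of_re_pos ?_ this
  simp; positivity

lemma factorial_prod_le_factorial_sum {n : ℕ} (m : Fin n → ℕ) :
    ∏ i, (m i).factorial ≤ (∑ i, m i).factorial :=
  Nat.le_of_dvd (Nat.factorial_pos _) (Nat.prod_factorial_dvd_factorial_sum _ _)

/-! ### Multiple series and the binomial expansion -/

/-- The product of finitely many absolutely convergent series is the sum of the family of the
products of their terms, which is absolutely summable. -/
lemma hasSum_prod_pi {n : ℕ} (f : Fin n → ℕ → ℂ) (s : Fin n → ℂ)
    (hs : ∀ i, HasSum (f i) (s i)) (hf : ∀ i, Summable fun k => ‖f i k‖) :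
    HasSum (fun m : Fin n → ℕ => ∏ i, f i (m i)) (∏ i, s i) ∧
      Summable fun m : Fin n → ℕ => ‖∏ i, f i (m i)‖ := by
  induction n with
  | zero => exact ⟨by simp, Summable.of_finite⟩
  | succ n ih =>
    obtain ⟨h1, h2⟩ := ih (fun i => f i.succ) (fun i => s i.succ) (fun i => hs _) fun i => hf _
    have h3 := summable_mul_of_summable_norm (hf 0) h2
    have h4 := Summable.mul_norm (hf 0) h2
    have h5 := (hs 0).mul h1 h3
    constructor
    · rw [← (Fin.consEquiv fun _ : Fin (n + 1) => ℕ).hasSum_iff]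
      convert! h5 using 1
      · ext p; simp [Fin.prod_univ_succ]
      · simp [Fin.prod_univ_succ]
    · rw [← (Fin.consEquiv fun _ : Fin (n + 1) => ℕ).summable_iff]
      convert! h4 using 1
      ext p; simp [Fin.prod_univ_succ]

/-- The binomial series of `(1 - x) ^ (-b)`. -/
lemma hasSum_binomial (b : ℂ) {x : ℂ} (hx : ‖x‖ < 1) :
    HasSum (fun m : ℕ => poch b m * (x ^ m / (m.factorial : ℂ))) ((1 - x) ^ (-b)) ∧
      Summable fun m : ℕ => ‖poch b m * (x ^ m / (m.factorial : ℂ))‖ := by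
  have H := Complex.one_div_one_sub_cpow_hasFPowerSeriesOnBall_zero b
  have hx' : x ∈ Metric.eball (0 : ℂ) 1 := by
    rw [mem_eball_zero_iff, ← ofReal_norm, ENNReal.ofReal_lt_one]; exact hx
  have hc (m : ℕ) : FormalMultilinearSeries.ofScalars ℂ
      (fun n : ℕ ↦ Ring.choose (b + n - 1) n) m (fun _ => x) =
      poch b m * (x ^ m / (m.factorial : ℂ)) := by
    -- The coefficient choose (b + m - 1) m is `Ring.multichoose b m`, which is (b)_m / m!.
    have h1 := Ring.factorial_nsmul_multichoose_eq_ascPochhammer b m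
    rw [Ring.multichoose_eq, Polynomial.ascPochhammer_smeval_eq_eval, nsmul_eq_mul] at h1
    have : (m.factorial : ℂ) ≠ 0 := by exact_mod_cast m.factorial_ne_zero
    simp only [FormalMultilinearSeries.ofScalars_apply_eq, smul_eq_mul]
    rw [poch, ← h1]
    field_simp
  constructor
  · have h2 := H.hasSum hx'
    simp only [hc, zero_add] at h2
    rwa [one_div, ← Complex.cpow_neg] at h2
  · have h2 := FormalMultilinearSeries.summable_norm_apply _
      (Metric.eball_subset_eball H.r_le hx')
    simpa only [hc] using h2

lemma hasSum_prod_binomial {n : ℕ} (b x : Fin n → ℂ) (hx : ∀ i, ‖x i‖ < 1) :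
    HasSum (fun m : Fin n → ℕ => ∏ i, poch (b i) (m i) * (x i ^ m i / ((m i).factorial : ℂ)))
      (∏ i, (1 - x i) ^ (-b i)) ∧
    Summable (fun m : Fin n → ℕ =>
      ‖∏ i, poch (b i) (m i) * (x i ^ m i / ((m i).factorial : ℂ))‖) :=
  hasSum_prod_pi (fun i m => poch (b i) m * (x i ^ m / (m.factorial : ℂ))) _
    (fun i => (hasSum_binomial (b i) (hx i)).1) fun i => (hasSum_binomial (b i) (hx i)).2

/-! ### Principal powers in the right half-plane -/

/-- Both arguments lie in (-π/2, π/2), so their difference stays in (-π, π) and no branch correction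
appears. -/
lemma log_div_of_re_pos {z w : ℂ} (hz : 0 < z.re) (hw : 0 < w.re) :
    Complex.log (z / w) = Complex.log z - Complex.log w := by
  have hw0 : w ≠ 0 := by rintro rfl; simp at hw
  have hz0 : z ≠ 0 := by rintro rfl; simp at hz
  have h1 := abs_lt.1 (Complex.abs_arg_lt_pi_div_two_iff.2 (Or.inl hz))
  have h2 := abs_lt.1 (Complex.abs_arg_lt_pi_div_two_iff.2 (Or.inl hw))
  have h3 : w.arg ≠ Real.pi := by linarith [Real.pi_pos]
  rw [div_eq_mul_inv, Complex.log_mul hz0 (inv_ne_zero hw0), Complex.log_inv _ h3, sub_eq_add_neg]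
  rw [Complex.arg_inv, if_neg h3]
  constructor <;> linarith

/-- The behaviour of a factor `(1 - s / a) ^ (-b)` at `s = -t`, for `t > 0`. -/
lemma one_add_div_cpow {a : ℂ} (ha : 0 < a.re) {t : ℝ} (ht : 0 < t) (b : ℂ) :
    (1 + t / a) ^ (-b) = a ^ b * (t : ℂ) ^ (-b) * (1 + a / t) ^ (-b) := by
  have ha0 : a ≠ 0 := by rintro rfl; simp at ha
  have ht0 : (t : ℂ) ≠ 0 := by exact_mod_cast ht.ne'
  have hs : 0 < (a + t).re := by simp; positivity
  have hs0 : a + t ≠ 0 := by intro h; simp [h] at hs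
  have e1 : 1 + t / a = (a + t) / a := by field_simp
  have e2 : 1 + a / t = (a + t) / t := by field_simp; ring
  have htr : 0 < (t : ℂ).re := by simpa
  rw [e1, e2, Complex.cpow_def_of_ne_zero (div_ne_zero hs0 ha0),
    Complex.cpow_def_of_ne_zero (div_ne_zero hs0 ht0), Complex.cpow_def_of_ne_zero ha0,
    Complex.cpow_def_of_ne_zero ht0, ← Complex.exp_add, ← Complex.exp_add,
    log_div_of_re_pos hs ha, log_div_of_re_pos hs htr]
  congr 1; ring

lemma prod_one_add_div_cpow {n : ℕ} {a : Fin n → ℂ} (ha : ∀ i, 0 < (a i).re) {t : ℝ} (ht : 0 < t)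
    (b : Fin n → ℂ) :
    ∏ i, (1 + t / a i) ^ (-b i) =
      (∏ i, a i ^ b i) * (t : ℂ) ^ (-∑ i, b i) * ∏ i, (1 + a i / t) ^ (-b i) := by
  have ht0 : (t : ℂ) ≠ 0 := by exact_mod_cast ht.ne'
  simp_rw [one_add_div_cpow (ha _) ht, Finset.prod_mul_distrib]
  simp_rw [← Finset.sum_neg_distrib, Complex.cpow_def_of_ne_zero ht0, Finset.mul_sum, Complex.exp_sum]

/-! ### Euler's integral for the Lauricella function F_D -/

lemma isOpen_lauricellaDomain (n : ℕ) : IsOpen (lauricellaDomain n) := by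
  have h : lauricellaDomain n = ⋂ i, {y : Fin n → ℂ | 1 - y i ∈ Complex.slitPlane} := by
    ext y; simp [lauricellaDomain]
  rw [h]
  exact isOpen_iInter_of_finite fun i =>
    Complex.isOpen_slitPlane.preimage (by fun_prop : Continuous fun y : Fin n → ℂ => 1 - y i)

lemma smul_mem_lauricellaDomain {n : ℕ} {x : Fin n → ℂ} (hx : x ∈ lauricellaDomain n) {t : ℝ}
    (h0 : 0 ≤ t) (h1 : t ≤ 1) : t • x ∈ lauricellaDomain n := by
  intro i
  have hi := hx i
  simp only [Pi.smul_apply, Complex.mem_slitPlane_iff, Complex.sub_re,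
    Complex.sub_im, Complex.one_re, Complex.one_im, Complex.real_smul,
    Complex.re_ofReal_mul, Complex.im_ofReal_mul] at hi ⊢
  rcases h0.eq_or_lt with rfl | hs
  · left; simp
  · rcases hi with hi | hi
    · left; nlinarith
    · right
      simp only [zero_sub, ne_eq, neg_eq_zero, mul_eq_zero, not_or] at hi ⊢
      exact ⟨hs.ne', hi⟩

/-- A weighted average of the dilates of a holomorphic function on a star-shaped open set is
holomorphic. -/
lemma differentiableOn_integral_smul {E : Type*} [NormedAddCommGroup E] [NormedSpace ℂ E]
    [FiniteDimensional ℂ E] {U : Set E} (hU : IsOpen U)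
    (hstar : ∀ x ∈ U, ∀ t : ℝ, 0 ≤ t → t ≤ 1 → t • x ∈ U) {f : E → ℂ} (hf : ContDiffOn ℂ 1 f U)
    {w : ℝ → ℂ} (hw : IntervalIntegrable w volume 0 1) :
    DifferentiableOn ℂ (fun x => ∫ t in (0 : ℝ)..1, w t * f (t • x)) U := by
  intro x₀ hx₀
  have : ProperSpace E := FiniteDimensional.proper_rclike ℂ E
  obtain ⟨ε, hε, hball⟩ := Metric.nhds_basis_closedBall.mem_iff.1 (hU.mem_nhds hx₀)
  have hfc : ContinuousOn f U := hf.continuousOn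
  have hfd : ContinuousOn (fderiv ℂ f) U := hf.continuousOn_fderiv_of_isOpen hU le_rfl
  have hmap : Set.MapsTo (fun p : E × ℝ => p.2 • p.1) (Metric.closedBall x₀ ε ×ˢ Set.Icc 0 1) U :=
    fun p hp => hstar _ (hball hp.1) _ hp.2.1 hp.2.2
  have hmap' (x : E) (hx : x ∈ U) : Set.MapsTo (fun t : ℝ => t • x) (Set.Icc 0 1) U :=
    fun t ht => hstar _ hx _ ht.1 ht.2
  have hcont : ContinuousOn (fun p : E × ℝ => p.2 • fderiv ℂ f (p.2 • p.1))
      (Metric.closedBall x₀ ε ×ˢ Set.Icc 0 1) :=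
    continuousOn_snd.smul (hfd.comp (by fun_prop) hmap)
  -- Compactness of the ball times [0, 1] bounds the derivative of the dilates uniformly, so |w| C
  -- dominates the differentiated integrand.
  obtain ⟨C, hC⟩ := ((isCompact_closedBall x₀ ε).prod isCompact_Icc).exists_bound_of_continuousOn
    hcont
  have hsub : Set.uIoc (0 : ℝ) 1 ⊆ Set.Icc 0 1 := by
    rw [Set.uIoc_of_le zero_le_one]; exact Set.Ioc_subset_Icc_self
  have hwm : AEStronglyMeasurable w (volume.restrict (Set.uIoc 0 1)) :=
    (intervalIntegrable_iff.1 hw).aestronglyMeasurable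
  have hfi (x : E) (hx : x ∈ U) : ContinuousOn (fun t : ℝ => f (t • x)) (Set.Icc 0 1) :=
    hfc.comp (by fun_prop) (hmap' x hx)
  have key := intervalIntegral.hasFDerivAt_integral_of_dominated_of_fderiv_le (𝕜 := ℂ)
    (μ := volume) (a := 0) (b := 1) (F := fun x t => w t * f (t • x))
    (F' := fun x t => w t • (t • fderiv ℂ f (t • x))) (x₀ := x₀) (s := Metric.ball x₀ ε)
    (bound := fun t => ‖w t‖ * C) (Metric.ball_mem_nhds _ hε) ?_ ?_ ?_ ?_ ?_ ?_
  · exact key.differentiableAt.differentiableWithinAt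
  · filter_upwards [hU.mem_nhds hx₀] with x hx
    exact hwm.mul (((hfi x hx).mono hsub).aestronglyMeasurable measurableSet_uIoc)
  · refine hw.mul_continuousOn ?_
    rw [Set.uIcc_of_le zero_le_one]
    exact hfi x₀ hx₀
  · refine hwm.smul (ContinuousOn.aestronglyMeasurable (ContinuousOn.mono ?_ hsub)
      measurableSet_uIoc)
    exact continuousOn_id.smul (hfd.comp (by fun_prop) (hmap' x₀ hx₀))
  · refine Filter.Eventually.of_forall fun t ht x hx => ?_
    rw [norm_smul]
    gcongr
    exact hC (x, t) ⟨Metric.ball_subset_closedBall hx, hsub ht⟩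
  · exact hw.norm.mul_const C
  · refine Filter.Eventually.of_forall fun t ht x hx => ?_
    have hxU := hball (Metric.ball_subset_closedBall hx)
    have h1 := ((hf.differentiableOn one_ne_zero).differentiableAt
      (hU.mem_nhds (hmap' x hxU (hsub ht)))).hasFDerivAt
    have h2 := h1.comp x ((hasFDerivAt_id x).const_smul t)
    have h3 := h2.const_mul (w t)
    convert! h3 using 1
    ext v
    simp

/-- Euler's integral representation of the principal branch of `F_D⁽ⁿ⁾`. -/
noncomputable def lauricellaEuler {n : ℕ} (a : ℂ) (b : Fin n → ℂ) (c : ℂ) (x : Fin n → ℂ) : ℂ :=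
  Complex.Gamma c / (Complex.Gamma a * Complex.Gamma (c - a)) *
    ∫ t in (0 : ℝ)..1, ((t : ℂ) ^ (a - 1) * (1 - (t : ℂ)) ^ (c - a - 1)) *
      ∏ i, (1 - (t : ℂ) * x i) ^ (-b i)

/-- Expanding the product in binomial series and integrating termwise leaves the Beta integrals B(a
+ |m|, c - a), whose Gamma quotients produce (a)_{|m|} / (c)_{|m|}. Since t ≤ 1, the series at t = 1
dominates. -/
lemma hasSum_lauricellaEuler {n : ℕ} {a c : ℂ} (b : Fin n → ℂ) (ha : 0 < a.re)
    (hca : 0 < (c - a).re) {x : Fin n → ℂ} (hx : ∀ i, ‖x i‖ < 1) :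
    HasSum (lauricellaFDTerm a b c x) (lauricellaEuler a b c x) := by
  set W : ℝ → ℂ := fun t => (t : ℂ) ^ (a - 1) * (1 - (t : ℂ)) ^ (c - a - 1) with hW
  have hWi : Integrable W (volume.restrict (Set.Ioc 0 1)) :=
    (intervalIntegrable_iff_integrableOn_Ioc_of_le zero_le_one).1
      (Complex.betaIntegral_convergent ha hca)
  set T : (Fin n → ℕ) → ℂ :=
    fun m => ∏ i, poch (b i) (m i) * (x i ^ m i / ((m i).factorial : ℂ)) with hT
  have hc : 0 < c.re := by simp at hca; linarith
  have hterm (m : Fin n → ℕ) (t : ℝ) :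
      ∏ i, poch (b i) (m i) * (((t : ℂ) * x i) ^ m i / ((m i).factorial : ℂ)) =
        (t : ℂ) ^ (∑ i, m i) * T m := by
    rw [hT, ← Finset.prod_pow_eq_pow_sum, ← Finset.prod_mul_distrib]
    exact Finset.prod_congr rfl fun i _ => by rw [mul_pow]; ring
  have hint (m : Fin n → ℕ) : Integrable (fun t : ℝ => W t * ((t : ℂ) ^ (∑ i, m i) * T m))
      (volume.restrict (Set.Ioc 0 1)) := by
    refine (intervalIntegrable_iff_integrableOn_Ioc_of_le zero_le_one).1 ?_
    exact (Complex.betaIntegral_convergent ha hca).mul_continuousOn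
      (by fun_prop : Continuous fun t : ℝ => (t : ℂ) ^ (∑ i, m i) * T m).continuousOn
  have hsum : Summable fun m : Fin n → ℕ =>
      ∫ t in Set.Ioc (0 : ℝ) 1, ‖W t * ((t : ℂ) ^ (∑ i, m i) * T m)‖ := by
    refine Summable.of_nonneg_of_le (fun m => integral_nonneg fun t => norm_nonneg _) (fun m => ?_)
      ((hasSum_prod_binomial b x hx).2.mul_left (∫ t in Set.Ioc (0 : ℝ) 1, ‖W t‖))
    rw [← integral_mul_const]
    refine integral_mono_ae (hint m).norm (hWi.norm.mul_const _) ?_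
    refine (ae_restrict_iff' measurableSet_Ioc).2 (Filter.Eventually.of_forall fun t ht => ?_)
    simp only [norm_mul, norm_pow, Complex.norm_real, Real.norm_eq_abs, abs_of_pos ht.1]
    have : t ^ (∑ i, m i) ≤ 1 := pow_le_one₀ ht.1.le ht.2
    have h0 : 0 ≤ ‖T m‖ := norm_nonneg _
    calc ‖W t‖ * (t ^ (∑ i, m i) * ‖T m‖) ≤ ‖W t‖ * (1 * ‖T m‖) := by gcongr
      _ = ‖W t‖ * ‖T m‖ := by rw [one_mul]
      _ = _ := by rw [hT]
  have H := (hasSum_integral_of_summable_integral_norm hint hsum).mul_left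
    (Complex.Gamma c / (Complex.Gamma a * Complex.Gamma (c - a)))
  convert! H using 1
  · ext m
    have hm : 0 < (a + (∑ i, m i : ℕ)).re := by simp; positivity
    have e1 : ∫ t in Set.Ioc (0 : ℝ) 1, W t * ((t : ℂ) ^ (∑ i, m i) * T m) =
        Complex.betaIntegral (a + (∑ i, m i : ℕ)) (c - a) * T m := by
      rw [Complex.betaIntegral, intervalIntegral.integral_of_le zero_le_one, ← integral_mul_const]
      refine setIntegral_congr_fun measurableSet_Ioc fun t ht => ?_
      have ht0 : (t : ℂ) ≠ 0 := by exact_mod_cast ht.1.ne'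
      simp only [hW]
      rw [show a + ((∑ i, m i : ℕ) : ℂ) - 1 = (a - 1) + ((∑ i, m i : ℕ) : ℂ) by ring,
        Complex.cpow_add _ _ ht0, Complex.cpow_natCast]
      ring
    rw [e1, Complex.betaIntegral_eq_Gamma_mul_div _ _ hm hca, Gamma_add_natCast_eq ha,
      show a + ((∑ i, m i : ℕ) : ℂ) + (c - a) = c + ((∑ i, m i : ℕ) : ℂ) by ring,
      Gamma_add_natCast_eq hc, lauricellaFDTerm, hT]
    simp only [Finset.prod_mul_distrib]
    have g1 := Complex.Gamma_ne_zero_of_re_pos ha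
    have g2 := Complex.Gamma_ne_zero_of_re_pos hc
    have g3 := Complex.Gamma_ne_zero_of_re_pos hca
    have g4 := poch_ne_zero hc (∑ i, m i)
    field_simp
  · rw [lauricellaEuler, intervalIntegral.integral_of_le zero_le_one]
    congr 1
    refine setIntegral_congr_fun measurableSet_Ioc fun t ht => ?_
    have hx' : ∀ i, ‖(t : ℂ) * x i‖ < 1 := fun i => by
      rw [norm_mul, Complex.norm_real, Real.norm_eq_abs, abs_of_pos ht.1]
      nlinarith [norm_nonneg (x i), hx i, ht.1, ht.2]
    have := (hasSum_prod_binomial b _ hx').1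
    simp only [hterm] at this
    exact (this.mul_left (W t)).tsum_eq.symm

theorem isLauricellaFD_lauricellaEuler {n : ℕ} {a c : ℂ} (b : Fin n → ℂ) (ha : 0 < a.re)
    (hca : 0 < (c - a).re) : IsLauricellaFD a b c (lauricellaEuler a b c) where
  hasSum _ hx := hasSum_lauricellaEuler b ha hca hx
  differentiableOn := by
    have hf : ContDiffOn ℂ 1 (fun x : Fin n → ℂ => ∏ i, (1 - x i) ^ (-b i))
        (lauricellaDomain n) := by
      refine contDiffOn_prod fun i _ => ?_
      intro x hx
      refine ContDiffAt.contDiffWithinAt ?_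
      have h2 : ContDiffAt ℂ 1 (fun z : ℂ => z ^ (-b i)) (1 - x i) := by
        refine (DifferentiableOn.contDiffOn (s := Complex.slitPlane) (fun z hz => ?_)
          Complex.isOpen_slitPlane).contDiffAt (Complex.isOpen_slitPlane.mem_nhds (hx i))
        exact (differentiableAt_id.cpow_const hz).differentiableWithinAt
      exact ContDiffAt.comp (f := fun y : Fin n → ℂ => 1 - y i) x h2 (by fun_prop)
    have := differentiableOn_integral_smul (isOpen_lauricellaDomain n)
      (fun x hx t h0 h1 => smul_mem_lauricellaDomain hx h0 h1) hf
      (Complex.betaIntegral_convergent ha hca)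
    simpa [lauricellaEuler] using! this.const_mul _

/-- Euler's integral witnesses the existence in the definition of `lauricellaFD`; by uniqueness of
the branch the chosen function agrees with it. -/
theorem lauricellaFD_eq_lauricellaEuler {n : ℕ} {a c : ℂ} (b : Fin n → ℂ) (ha : 0 < a.re)
    (hca : 0 < (c - a).re) {x : Fin n → ℂ} (hx : x ∈ lauricellaDomain n) :
    lauricellaFD a b c x = lauricellaEuler a b c x := by
  have h : ∃ F : (Fin n → ℂ) → ℂ, IsLauricellaFD a b c F :=
    ⟨_, isLauricellaFD_lauricellaEuler b ha hca⟩
  rw [lauricellaFD, dif_pos h]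
  exact h.choose_spec.eqOn (isLauricellaFD_lauricellaEuler b ha hca) hx

/-! ### Craig's formula for the Gaussian Q-function -/

lemma integral_mul_exp_neg_sq {a : ℝ} (ha : 0 ≤ a) (w : ℝ) :
    ∫ r in Set.Ioi a, r * Real.exp (-r ^ 2 * (1 + w ^ 2) / 2) =
      (1 + w ^ 2)⁻¹ * Real.exp (-a ^ 2 * (1 + w ^ 2) / 2) := by
  have hw : 0 < 1 + w ^ 2 := by positivity
  have hderiv : ∀ r ∈ Set.Ici a, HasDerivAt
      (fun r : ℝ => -((1 + w ^ 2)⁻¹ * Real.exp (-r ^ 2 * (1 + w ^ 2) / 2)))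
      (r * Real.exp (-r ^ 2 * (1 + w ^ 2) / 2)) r := by
    intro r _
    have h1 : HasDerivAt (fun r : ℝ => -r ^ 2 * (1 + w ^ 2) / 2) (-(2 * r) * (1 + w ^ 2) / 2) r := by
      simpa using ((hasDerivAt_pow 2 r).neg.mul_const (1 + w ^ 2)).div_const 2
    refine ((h1.exp.const_mul (1 + w ^ 2)⁻¹).neg).congr_deriv ?_
    field_simp
  have hlim : Filter.Tendsto
      (fun r : ℝ => -((1 + w ^ 2)⁻¹ * Real.exp (-r ^ 2 * (1 + w ^ 2) / 2))) Filter.atTop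
      (nhds 0) := by
    have h2 : Filter.Tendsto (fun r : ℝ => -r ^ 2 * (1 + w ^ 2) / 2) Filter.atTop
        Filter.atBot := by
      have h3 : Filter.Tendsto (fun r : ℝ => r ^ 2 * ((1 + w ^ 2) / 2)) Filter.atTop
          Filter.atTop :=
        (Filter.tendsto_pow_atTop two_ne_zero).atTop_mul_const (by positivity)
      refine (Filter.tendsto_neg_atTop_atBot.comp h3).congr fun r => ?_
      simp only [Function.comp_apply]; ring
    simpa using ((Real.tendsto_exp_atBot.comp h2).const_mul (1 + w ^ 2)⁻¹).neg
  rw [integral_Ioi_of_hasDerivAt_of_nonneg' hderiv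
    (fun r hr => mul_nonneg (ha.trans (le_of_lt hr)) (Real.exp_nonneg _)) hlim]
  ring

lemma integrableOn_exp_neg_half_sq (a : ℝ) :
    IntegrableOn (fun r : ℝ => Real.exp (-r ^ 2 / 2)) (Set.Ioi a) := by
  refine ((integrable_exp_neg_mul_sq (b := 1 / 2) (by norm_num)).congr ?_).integrableOn
  exact Filter.Eventually.of_forall fun r => by ring_nf

/-- The function r exp(-r²(1 + w²)/2) is integrated over r > a, w > 0 in both orders. Up to the
substitution u = r w this is the planar Gaussian on r > a, u > 0. Integrating in w first gives a
multiple of Q(a), integrating in r first gives the right side. -/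
lemma gaussianQ_eq_integral_Ioi {a : ℝ} (ha : 0 ≤ a) :
    gaussianQ a =
      Real.pi⁻¹ * ∫ w in Set.Ioi (0 : ℝ), (1 + w ^ 2)⁻¹ * Real.exp (-a ^ 2 * (1 + w ^ 2) / 2) := by
  have hsplit (r w : ℝ) : r * Real.exp (-r ^ 2 * (1 + w ^ 2) / 2) =
      (r * Real.exp (-r ^ 2 / 2)) * Real.exp (-(r ^ 2 / 2) * w ^ 2) := by
    rw [mul_assoc, ← Real.exp_add]; congr 2; ring
  have hinner : ∀ r ∈ Set.Ioi a, ∫ w in Set.Ioi (0 : ℝ), r * Real.exp (-r ^ 2 * (1 + w ^ 2) / 2) =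
      √(2 * Real.pi) / 2 * Real.exp (-r ^ 2 / 2) := by
    intro r hr
    have hr0 : 0 < r := lt_of_le_of_lt ha hr
    simp_rw [hsplit]
    rw [integral_const_mul, integral_gaussian_Ioi,
      show Real.pi / (r ^ 2 / 2) = (2 * Real.pi) / r ^ 2 by field_simp,
      Real.sqrt_div (by positivity), Real.sqrt_sq hr0.le]
    field_simp
  have hint : Integrable (Function.uncurry fun r w : ℝ => r * Real.exp (-r ^ 2 * (1 + w ^ 2) / 2))
      ((volume.restrict (Set.Ioi a)).prod (volume.restrict (Set.Ioi (0 : ℝ)))) := by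
    rw [integrable_prod_iff (Continuous.aestronglyMeasurable (by
      simp only [Function.uncurry_def]; fun_prop))]
    constructor
    · refine (ae_restrict_iff' measurableSet_Ioi).2 (Filter.Eventually.of_forall fun r hr => ?_)
      have hr0 : 0 < r := lt_of_le_of_lt ha hr
      simp only [Function.uncurry_apply_pair, hsplit]
      exact ((integrable_exp_neg_mul_sq (b := r ^ 2 / 2) (by positivity)).integrableOn).const_mul _
    · refine IntegrableOn.congr_fun
        ((integrableOn_exp_neg_half_sq a).const_mul (√(2 * Real.pi) / 2)) (fun r hr => ?_)
        measurableSet_Ioi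
      have hr0 : 0 < r := lt_of_le_of_lt ha hr
      simp only [Function.uncurry_apply_pair, norm_mul, Real.norm_eq_abs, abs_of_pos hr0,
        Real.abs_exp]
      exact (hinner r hr).symm
  have hswap := integral_integral_swap hint
  rw [setIntegral_congr_fun measurableSet_Ioi hinner, integral_const_mul] at hswap
  simp_rw [integral_mul_exp_neg_sq ha] at hswap
  rw [← hswap, gaussianQ]
  have hp : √(2 * Real.pi) ^ 2 = 2 * Real.pi := Real.sq_sqrt (by positivity)
  have hp0 : √(2 * Real.pi) ≠ 0 := by positivity
  have hpi := Real.pi_ne_zero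
  rw [← mul_assoc]
  congr 1
  field_simp
  linarith

/-- Craig's formula for the Gaussian `Q`-function, in algebraic form. -/
lemma gaussianQ_sqrt_eq {y : ℝ} (hy : 0 ≤ y) :
    gaussianQ (√y) = (2 * Real.pi)⁻¹ *
      ∫ t in Set.Ioo (0 : ℝ) 1, (√t * √(1 - t))⁻¹ * Real.exp (-(y / (2 * t))) := by
  -- The substitution is t = 1 / (1 + w²), which maps (0, ∞) bijectively onto (0, 1).
  have himage : (fun w : ℝ => (1 + w ^ 2)⁻¹) '' Set.Ioi 0 = Set.Ioo 0 1 := by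
    ext t
    constructor
    · rintro ⟨w, hw, rfl⟩
      have hw : 0 < w := hw
      exact ⟨by positivity, inv_lt_one_of_one_lt₀ (by nlinarith)⟩
    · rintro ⟨h0, h1⟩
      have : 0 < t⁻¹ - 1 := by rw [sub_pos]; exact (one_lt_inv₀ h0).2 h1
      refine ⟨√(t⁻¹ - 1), Real.sqrt_pos.2 this, ?_⟩
      simp [Real.sq_sqrt this.le]
  have hderiv : ∀ w ∈ Set.Ioi (0 : ℝ), HasDerivWithinAt (fun w : ℝ => (1 + w ^ 2)⁻¹)
      (-(2 * w) / (1 + w ^ 2) ^ 2) (Set.Ioi 0) w := by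
    intro w _
    have h1 : HasDerivAt (fun w : ℝ => 1 + w ^ 2) (2 * w) w := by
      simpa using (hasDerivAt_pow 2 w).const_add 1
    exact (h1.fun_inv (by positivity)).hasDerivWithinAt
  have hinj : Set.InjOn (fun w : ℝ => (1 + w ^ 2)⁻¹) (Set.Ioi 0) := by
    intro u hu v hv huv
    have hu : 0 < u := hu
    have hv : 0 < v := hv
    have := inv_injective huv
    nlinarith
  rw [gaussianQ_eq_integral_Ioi (Real.sqrt_nonneg y), Real.sq_sqrt hy, ← himage,
    integral_image_eq_integral_abs_deriv_smul measurableSet_Ioi hderiv hinj,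
    ← integral_const_mul, ← integral_const_mul]
  refine setIntegral_congr_fun measurableSet_Ioi fun w hw => ?_
  have hw : 0 < w := hw
  have hs : 0 < 1 + w ^ 2 := by positivity
  have e1 : 1 - (1 + w ^ 2)⁻¹ = w ^ 2 / (1 + w ^ 2) := by field_simp; ring
  have e2 : √(1 + w ^ 2) ^ 2 = 1 + w ^ 2 := Real.sq_sqrt hs.le
  have e3 : √((1 + w ^ 2)⁻¹) * √(1 - (1 + w ^ 2)⁻¹) = w / (1 + w ^ 2) := by
    rw [e1, Real.sqrt_inv, Real.sqrt_div (by positivity), Real.sqrt_sq hw.le]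
    field_simp
    rw [e2]
  have e4 : |-(2 * w) / (1 + w ^ 2) ^ 2| = 2 * w / (1 + w ^ 2) ^ 2 := by
    rw [neg_div, abs_neg, abs_of_pos (by positivity)]
  have e5 : -(y / (2 * (1 + w ^ 2)⁻¹)) = -y * (1 + w ^ 2) / 2 := by field_simp
  simp only [smul_eq_mul]
  rw [e3, e4, e5]
  have hpi := Real.pi_ne_zero
  field_simp

/-! ### The Q-transform of a posynomial variable -/

lemma intervalIntegrable_betaIntegrand_mul {n : ℕ} {u v : ℂ} (hu : 0 < u.re) (hv : 0 < v.re)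
    (b : Fin n → ℂ) {x : Fin n → ℂ} (hx : x ∈ lauricellaDomain n) :
    IntervalIntegrable (fun t : ℝ => ((t : ℂ) ^ (u - 1) * (1 - (t : ℂ)) ^ (v - 1)) *
      ∏ i, (1 - (t : ℂ) * x i) ^ (-b i)) volume 0 1 := by
  refine (Complex.betaIntegral_convergent hu hv).mul_continuousOn ?_
  rw [Set.uIcc_of_le zero_le_one]
  refine continuousOn_finsetProd _ fun i _ => ?_
  refine ContinuousOn.cpow (by fun_prop) continuousOn_const fun t ht => ?_
  simpa using smul_mem_lauricellaDomain hx ht.1 ht.2 i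

lemma ofReal_sqrt_mul_sqrt_inv {t : ℝ} (ht : t ∈ Set.Ioo (0 : ℝ) 1) :
    (((√t * √(1 - t))⁻¹ : ℝ) : ℂ) =
      (t : ℂ) ^ ((1 / 2 : ℂ) - 1) * (1 - (t : ℂ)) ^ ((1 / 2 : ℂ) - 1) := by
  have h1 : 0 < 1 - t := by linarith [ht.2]
  have key {s : ℝ} (hs : 0 < s) : (((√s)⁻¹ : ℝ) : ℂ) = (s : ℂ) ^ ((1 / 2 : ℂ) - 1) := by
    rw [Real.sqrt_eq_rpow, ← Real.rpow_neg hs.le, Complex.ofReal_cpow hs.le]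
    congr 1; push_cast; ring
  rw [mul_inv, Complex.ofReal_mul, key ht.1, key h1]
  push_cast; rfl

/-- The `Q`-transform of a nonnegative random variable in terms of its moment generating
function. -/
theorem gaussianQTransform_eq_integral_complexMGF {Ω : Type*} [MeasurableSpace Ω] (P : Measure Ω)
    [IsProbabilityMeasure P] {γ : Ω → ℝ} (hγ : AEMeasurable γ P) (h0 : ∀ᵐ ω ∂P, 0 ≤ γ ω) {p : ℝ}
    (hp : 0 < p) :
    ((gaussianQTransform γ P p : ℝ) : ℂ) = (2 * (Real.pi : ℂ))⁻¹ *
      ∫ t in Set.Ioo (0 : ℝ) 1, ((t : ℂ) ^ ((1 / 2 : ℂ) - 1) * (1 - (t : ℂ)) ^ ((1 / 2 : ℂ) - 1)) *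
        complexMGF γ P (-((p / (2 * t) : ℝ) : ℂ)) := by
  have hre : (0 : ℝ) < (1 / 2 : ℂ).re := by norm_num
  have hW : Integrable (fun t : ℝ => (t : ℂ) ^ ((1 / 2 : ℂ) - 1) *
      (1 - (t : ℂ)) ^ ((1 / 2 : ℂ) - 1)) (volume.restrict (Set.Ioo 0 1)) :=
    ((intervalIntegrable_iff_integrableOn_Ioc_of_le zero_le_one).1
      (Complex.betaIntegral_convergent hre hre)).mono_set Set.Ioo_subset_Ioc_self
  set W : ℝ → ℂ := fun t => (t : ℂ) ^ ((1 / 2 : ℂ) - 1) * (1 - (t : ℂ)) ^ ((1 / 2 : ℂ) - 1)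
  have hint : Integrable (Function.uncurry fun (ω : Ω) (t : ℝ) =>
      W t * Complex.exp (-((p / (2 * t) : ℝ) : ℂ) * γ ω)) (P.prod (volume.restrict (Set.Ioo 0 1))) := by
    refine Integrable.mono' (hW.norm.comp_snd P) ?_ ?_
    · refine AEStronglyMeasurable.mul hW.1.comp_snd (AEMeasurable.aestronglyMeasurable ?_)
      have hγ' : AEMeasurable (fun q : Ω × ℝ => γ q.1) (P.prod (volume.restrict (Set.Ioo 0 1))) :=
        hγ.comp_quasiMeasurePreserving Measure.quasiMeasurePreserving_fst
      have hm : Measurable fun q : Ω × ℝ => -((p / (2 * q.2) : ℝ) : ℂ) := by fun_prop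
      exact Complex.measurable_exp.comp_aemeasurable
        (hm.aemeasurable.mul (Complex.measurable_ofReal.comp_aemeasurable hγ'))
    · have h1 := (Measure.quasiMeasurePreserving_fst (μ := P)
        (ν := volume.restrict (Set.Ioo (0 : ℝ) 1))).ae h0
      have h2 := (Measure.quasiMeasurePreserving_snd (μ := P)
        (ν := volume.restrict (Set.Ioo (0 : ℝ) 1))).ae (ae_restrict_mem measurableSet_Ioo)
      filter_upwards [h1, h2] with q hq1 hq2
      -- As γ ≥ 0, the exponential has modulus at most 1, so the Beta weight dominates.
      simp only [Function.uncurry_def, norm_mul, Complex.norm_exp]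
      refine mul_le_of_le_one_right (norm_nonneg _) (Real.exp_le_one_iff.2 ?_)
      have : 0 ≤ p / (2 * q.2) * γ q.1 := mul_nonneg (div_nonneg hp.le (by linarith [hq2.1])) hq1
      rw [neg_mul, ← Complex.ofReal_mul, Complex.neg_re, Complex.ofReal_re]
      linarith
  have hcraig : ∀ᵐ ω ∂P, ((gaussianQ (√(p * γ ω)) : ℝ) : ℂ) = (2 * (Real.pi : ℂ))⁻¹ *
      ∫ t in Set.Ioo (0 : ℝ) 1, W t * Complex.exp (-((p / (2 * t) : ℝ) : ℂ) * γ ω) := by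
    filter_upwards [h0] with ω hω
    rw [gaussianQ_sqrt_eq (mul_nonneg hp.le hω), Complex.ofReal_mul, ← integral_complex_ofReal]
    congr 1
    · push_cast; rfl
    refine setIntegral_congr_fun measurableSet_Ioo fun t ht => ?_
    rw [Complex.ofReal_mul, ofReal_sqrt_mul_sqrt_inv ht, Complex.ofReal_exp]
    congr 2
    push_cast; ring
  rw [gaussianQTransform, ← integral_complex_ofReal, integral_congr_ae hcraig, integral_const_mul,
    integral_integral_swap hint]
  simp_rw [integral_const_mul]
  rfl

/-- The contribution of one summand of a posynomial moment generating function to the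
`Q`-transform. -/
lemma integral_betaIntegrand_mul_prod {n : ℕ} {a : Fin n → ℂ} (ha : ∀ i, 0 < (a i).re)
    (b : Fin n → ℂ) (hB : 0 < (∑ i, b i).re) {p : ℝ} (hp : 0 < p) :
    Integrable (fun t : ℝ => ((t : ℂ) ^ ((1 / 2 : ℂ) - 1) * (1 - (t : ℂ)) ^ ((1 / 2 : ℂ) - 1)) *
        ∏ i, (1 - -((p / (2 * t) : ℝ) : ℂ) / a i) ^ (-b i)) (volume.restrict (Set.Ioo 0 1)) ∧
    ∫ t in Set.Ioo (0 : ℝ) 1, ((t : ℂ) ^ ((1 / 2 : ℂ) - 1) * (1 - (t : ℂ)) ^ ((1 / 2 : ℂ) - 1)) *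
        ∏ i, (1 - -((p / (2 * t) : ℝ) : ℂ) / a i) ^ (-b i) =
      ((√Real.pi : ℝ) : ℂ) * ((∏ i, a i ^ b i) *
        (Complex.Gamma (1 / 2 + ∑ i, b i) / Complex.Gamma (1 + ∑ i, b i)) *
        (2 / (p : ℂ)) ^ (∑ i, b i) *
        lauricellaFD (1 / 2 + ∑ i, b i) b (1 + ∑ i, b i) (fun i => -(2 * a i) / (p : ℂ))) := by
  set B := ∑ i, b i with hBdef
  set x : Fin n → ℂ := fun i => -(2 * a i) / (p : ℂ) with hxdef
  have hp0 : (p : ℂ) ≠ 0 := by exact_mod_cast hp.ne'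
  -- The real part of -2a_i/p is negative, so the arguments avoid the cut [1, ∞).
  have hx : x ∈ lauricellaDomain n := fun i => Complex.mem_slitPlane_iff.2 <| Or.inl <| by
    have := ha i
    have h2 : 1 - x i = 1 + ((2 / p : ℝ) : ℂ) * a i := by
      simp only [hxdef]; push_cast; field_simp; ring
    rw [h2, Complex.add_re, Complex.re_ofReal_mul, Complex.one_re]
    positivity
  have hA : 0 < (1 / 2 + B).re := by rw [Complex.add_re]; norm_num; linarith
  have hC : 0 < (1 + B).re := by simp; linarith
  have hca : 1 + B - (1 / 2 + B) = 1 / 2 := by ring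
  have hhalf : (0 : ℝ) < (1 / 2 : ℂ).re := by norm_num
  -- The factor (p/(2t))^(-B) = (2/p)^B t^B shifts the exponent of t by B, giving Euler's integrand
  -- with parameters 1/2 + B and 1 + B.
  have hpt : Set.EqOn (fun t : ℝ => ((∏ i, a i ^ b i) * (2 / (p : ℂ)) ^ B) *
      (((t : ℂ) ^ (1 / 2 + B - 1) * (1 - (t : ℂ)) ^ ((1 / 2 : ℂ) - 1)) *
        ∏ i, (1 - (t : ℂ) * x i) ^ (-b i)))
      (fun t : ℝ => ((t : ℂ) ^ ((1 / 2 : ℂ) - 1) * (1 - (t : ℂ)) ^ ((1 / 2 : ℂ) - 1)) *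
        ∏ i, (1 - -((p / (2 * t) : ℝ) : ℂ) / a i) ^ (-b i)) (Set.Ioo 0 1) := by
    intro t ht
    have ht0 : (t : ℂ) ≠ 0 := by exact_mod_cast ht.1.ne'
    have hs : 0 < p / (2 * t) := div_pos hp (by linarith [ht.1])
    have e1 (i : Fin n) : 1 - -((p / (2 * t) : ℝ) : ℂ) / a i = 1 + ((p / (2 * t) : ℝ) : ℂ) / a i := by
      ring
    have e2 (i : Fin n) : 1 + a i / ((p / (2 * t) : ℝ) : ℂ) = 1 - (t : ℂ) * x i := by
      simp only [hxdef]; push_cast; field_simp; ring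
    have e3 : ((p / (2 * t) : ℝ) : ℂ) ^ (-B) = (2 / (p : ℂ)) ^ B * (t : ℂ) ^ B := by
      have h1 : ((p / (2 * t) : ℝ) : ℂ) = (((2 / p) * t : ℝ) : ℂ)⁻¹ := by
        push_cast; field_simp
      have h2 : (((2 / p) * t : ℝ) : ℂ).arg ≠ Real.pi := by
        rw [Complex.arg_ofReal_of_nonneg (mul_nonneg (by positivity) ht.1.le)]
        exact Real.pi_ne_zero.symm
      rw [h1, Complex.inv_cpow _ _ h2, Complex.cpow_neg, inv_inv, Complex.ofReal_mul,
        Complex.mul_cpow_ofReal_nonneg (by positivity) ht.1.le]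
      push_cast; rfl
    simp only [e1]
    rw [prod_one_add_div_cpow ha hs b, e3]
    simp only [e2]
    rw [show 1 / 2 + B - 1 = (1 / 2 - 1) + B by ring, Complex.cpow_add _ _ ht0]
    ring
  have hI := intervalIntegrable_betaIntegrand_mul hA hhalf b hx
  have hI' := (((intervalIntegrable_iff_integrableOn_Ioc_of_le zero_le_one).1 hI).mono_set
    Set.Ioo_subset_Ioc_self).const_mul ((∏ i, a i ^ b i) * (2 / (p : ℂ)) ^ B)
  refine ⟨IntegrableOn.congr_fun hI' hpt measurableSet_Ioo, ?_⟩
  rw [← setIntegral_congr_fun measurableSet_Ioo hpt, integral_const_mul,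
    lauricellaFD_eq_lauricellaEuler b hA (by rw [hca]; exact hhalf) hx, lauricellaEuler, hca,
    intervalIntegral.integral_of_le zero_le_one, integral_Ioc_eq_integral_Ioo,
    Complex.Gamma_one_half_eq]
  have g1 := Complex.Gamma_ne_zero_of_re_pos hA
  have g2 := Complex.Gamma_ne_zero_of_re_pos hC
  have g3 : ((√Real.pi : ℝ) : ℂ) = (Real.pi : ℂ) ^ (1 / 2 : ℂ) := by
    rw [Real.sqrt_eq_rpow, Complex.ofReal_cpow Real.pi_pos.le]; push_cast; rfl
  have g4 : (Real.pi : ℂ) ^ (1 / 2 : ℂ) ≠ 0 := by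
    rw [← g3]; exact_mod_cast (Real.sqrt_pos.2 Real.pi_pos).ne'
  rw [g3]
  generalize Complex.Gamma (1 / 2 + B) = G₁ at *
  generalize Complex.Gamma (1 + B) = G₂ at *
  generalize (Real.pi : ℂ) ^ (1 / 2 : ℂ) = q at *
  generalize (∫ t in Set.Ioo (0 : ℝ) 1, _ : ℂ) = J
  field_simp

theorem IsPosynomial.gaussianQTransform_eq {Ω : Type*} [MeasurableSpace Ω] {P : Measure Ω}
    [IsProbabilityMeasure P] {γ : Ω → ℝ} (hγ : AEMeasurable γ P)
    {K : ℕ} {n : Fin K → ℕ} {a b : (k : Fin K) → Fin (n k) → ℂ} {c : Fin K → ℂ}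
    (h : IsPosynomial γ P a b c) {p : ℝ} (hp : 0 < p) :
    ((gaussianQTransform γ P p : ℝ) : ℂ) =
      1 / (2 * ((√Real.pi : ℝ) : ℂ)) *
        ∑ k, c k * (∏ i, a k i ^ b k i) *
          (Complex.Gamma (1 / 2 + ∑ i, b k i) / Complex.Gamma (1 + ∑ i, b k i)) *
          (2 / (p : ℂ)) ^ (∑ i, b k i) *
          lauricellaFD (1 / 2 + ∑ i, b k i) (b k) (1 + ∑ i, b k i)
            (fun i => -(2 * a k i) / (p : ℂ)) := by
  have key (k : Fin K) := integral_betaIntegrand_mul_prod (h.re_pos k) (b k) (h.sum_pos k).1 hp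
  rw [gaussianQTransform_eq_integral_complexMGF P hγ h.nonneg hp]
  have e1 : ∫ t in Set.Ioo (0 : ℝ) 1,
      ((t : ℂ) ^ ((1 / 2 : ℂ) - 1) * (1 - (t : ℂ)) ^ ((1 / 2 : ℂ) - 1)) *
        complexMGF γ P (-((p / (2 * t) : ℝ) : ℂ)) =
      ∫ t in Set.Ioo (0 : ℝ) 1, ∑ k, c k *
        (((t : ℂ) ^ ((1 / 2 : ℂ) - 1) * (1 - (t : ℂ)) ^ ((1 / 2 : ℂ) - 1)) *
        ∏ i, (1 - -((p / (2 * t) : ℝ) : ℂ) / a k i) ^ (-b k i)) := by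
    refine setIntegral_congr_fun measurableSet_Ioo fun t ht => ?_
    have hs : 0 < p / (2 * t) := div_pos hp (by linarith [ht.1])
    rw [h.mgf_eq _ (by rw [Complex.neg_re, Complex.ofReal_re]; linarith), Finset.mul_sum]
    exact Finset.sum_congr rfl fun k _ => by ring
  rw [e1, integral_finsetSum _ fun k _ => (key k).1.const_mul (c k)]
  simp_rw [integral_const_mul, (key _).2]
  have hpi : (Real.pi : ℂ) = ((√Real.pi : ℝ) : ℂ) * ((√Real.pi : ℝ) : ℂ) := by
    rw [← Complex.ofReal_mul, Real.mul_self_sqrt Real.pi_pos.le]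
  have hs0 : ((√Real.pi : ℝ) : ℂ) ≠ 0 := by exact_mod_cast (Real.sqrt_pos.2 Real.pi_pos).ne'
  rw [hpi, Finset.mul_sum, Finset.mul_sum]
  refine Finset.sum_congr rfl fun k _ => ?_
  field_simp

/-! ### Uniqueness of Laplace transforms -/

/-- A locally Laplace transformable function whose Laplace transform vanishes on a real half-line
vanishes at its points of continuity. -/
theorem eq_zero_of_laplace_eq_zero {f : ℝ → ℂ} {σ : ℝ}
    (hf : ∀ t : ℝ, σ < t → IntegrableOn (fun x : ℝ => Complex.exp (-(t * x)) * f x) (Set.Ioi 0))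
    (h0 : ∀ t : ℝ, σ < t → ∫ x in Set.Ioi (0 : ℝ), Complex.exp (-(t * x)) * f x = 0)
    {x : ℝ} (hx : 0 < x) (hc : ContinuousAt f x) : f x = 0 := by
  have hnorm (z : ℂ) (y : ℝ) : ‖Complex.exp (-(z * y)) * f y‖ =
      ‖Complex.exp (-((z.re : ℂ) * y)) * f y‖ := by
    simp [Complex.norm_exp]
  have hmeas (z : ℂ) : AEStronglyMeasurable (fun y : ℝ => Complex.exp (-(z * y)) * f y)
      (volume.restrict (Set.Ioi 0)) := by
    -- Measurability is known only for damped copies of f; multiplying by the inverse exponential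
    -- undoes the damping.
    have h1 := (hf (σ + 1) (by linarith)).aestronglyMeasurable
    have h2 : Continuous fun y : ℝ => Complex.exp (-(z * y)) * Complex.exp ((σ + 1 : ℝ) * y) := by
      fun_prop
    refine (h2.aestronglyMeasurable.mul h1).congr (Filter.Eventually.of_forall fun y => ?_)
    simp only [Pi.mul_apply]
    rw [mul_assoc, ← mul_assoc (Complex.exp ((σ + 1 : ℝ) * y)), ← Complex.exp_add, add_neg_cancel,
      Complex.exp_zero, one_mul]
  have hint (z : ℂ) (hz : σ < z.re) : Integrable (fun y : ℝ => Complex.exp (-(z * y)) * f y)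
      (volume.restrict (Set.Ioi 0)) :=
    Integrable.mono (hf z.re hz) (hmeas z) (Filter.Eventually.of_forall fun y => (hnorm z y).le)
  set Λ : ℂ → ℂ := fun z => ∫ y in Set.Ioi (0 : ℝ), Complex.exp (-(z * y)) * f y with hΛ
  have hopen : IsOpen {z : ℂ | σ < z.re} := isOpen_lt continuous_const Complex.continuous_re
  have hdiff : DifferentiableOn ℂ Λ {z : ℂ | σ < z.re} := by
    intro z₀ hz₀
    have hz₀ : σ < z₀.re := hz₀
    -- On the ball Re z ≥ σ + 2ε. One ε absorbs the factor y through y ≤ ε⁻¹ exp(ε y), and the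
    -- abscissa σ + ε left over still gives integrability.
    set ε := (z₀.re - σ) / 3 with hε
    have hε0 : 0 < ε := by rw [hε]; linarith
    have key := hasDerivAt_integral_of_dominated_loc_of_deriv_le
      (μ := volume.restrict (Set.Ioi (0 : ℝ)))
      (F := fun z (y : ℝ) => Complex.exp (-(z * y)) * f y)
      (F' := fun z (y : ℝ) => -(y : ℂ) * (Complex.exp (-(z * y)) * f y)) (x₀ := z₀)
      (s := Metric.ball z₀ ε)
      (bound := fun y => ε⁻¹ * ‖Complex.exp (-(((σ + ε : ℝ) : ℂ) * y)) * f y‖)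
      (Metric.ball_mem_nhds _ hε0) (Filter.Eventually.of_forall fun z => hmeas z) (hint z₀ hz₀)
      ((by fun_prop : Continuous fun y : ℝ => -(y : ℂ)).aestronglyMeasurable.mul (hmeas z₀))
      ?_ ((hf _ (by linarith)).norm.const_mul _) ?_
    · exact key.2.differentiableAt.differentiableWithinAt
    · refine (ae_restrict_iff' measurableSet_Ioi).2 (Filter.Eventually.of_forall
        fun y hy z hz => ?_)
      have hy : 0 < y := hy
      have hre : σ + 2 * ε ≤ z.re := by
        have h1 := Complex.abs_re_le_norm (z - z₀)
        rw [mem_ball_iff_norm] at hz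
        have h2 := (abs_lt.1 (h1.trans_lt hz)).1
        rw [Complex.sub_re] at h2
        linarith
      simp only [norm_mul, norm_neg, Complex.norm_real, Real.norm_eq_abs, abs_of_pos hy,
        Complex.norm_exp]
      rw [← mul_assoc, ← mul_assoc]
      refine mul_le_mul_of_nonneg_right ?_ (norm_nonneg _)
      have e1 : (-(z * (y : ℂ))).re = -(z.re * y) := by simp
      have e2 : (-(((σ + ε : ℝ) : ℂ) * (y : ℂ))).re = -((σ + ε) * y) := by
        rw [← Complex.ofReal_mul, Complex.neg_re, Complex.ofReal_re]
      rw [e1, e2]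
      have h3 : y ≤ ε⁻¹ * Real.exp (ε * y) := by
        rw [inv_mul_eq_div, le_div_iff₀ hε0]
        linarith [Real.add_one_le_exp (ε * y)]
      calc y * Real.exp (-(z.re * y)) ≤ ε⁻¹ * Real.exp (ε * y) * Real.exp (-((σ + 2 * ε) * y)) := by
            gcongr
        _ = ε⁻¹ * Real.exp (-((σ + ε) * y)) := by
            rw [mul_assoc, ← Real.exp_add]; congr 2; ring
    · refine Filter.Eventually.of_forall fun y z _ => ?_
      have h1 : HasDerivAt (fun z : ℂ => -(z * (y : ℂ))) (-(y : ℂ)) z := by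
        simpa using ((hasDerivAt_id z).mul_const (y : ℂ)).fun_neg
      exact (h1.cexp.mul_const (f y)).congr_deriv (by ring)
  have hzero : Set.EqOn Λ 0 {z : ℂ | σ < z.re} := by
    -- Identity theorem: the zeros on the real half-line accumulate at σ + 1.
    refine (hdiff.analyticOnNhd hopen).eqOn_zero_of_preconnected_of_frequently_eq_zero
      (convex_halfSpace_re_gt σ).isPreconnected (z₀ := ((σ + 1 : ℝ) : ℂ)) (by simp) ?_
    have htend : Filter.Tendsto (fun t : ℝ => (t : ℂ)) (nhdsWithin (σ + 1) {σ + 1}ᶜ)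
        (nhdsWithin ((σ + 1 : ℝ) : ℂ) {((σ + 1 : ℝ) : ℂ)}ᶜ) := by
      refine tendsto_nhdsWithin_of_tendsto_nhds_of_eventually_within _
        (Complex.continuous_ofReal.continuousAt.tendsto.mono_left nhdsWithin_le_nhds) ?_
      filter_upwards [self_mem_nhdsWithin] with t ht
      simpa [-Complex.ofReal_add] using ht
    refine htend.frequently (Filter.Eventually.frequently ?_)
    filter_upwards [nhdsWithin_le_nhds (lt_mem_nhds (by linarith : σ < σ + 1))] with t ht
    exact h0 t ht
  -- The transform on the vertical line Re z = σ + 1 is the Fourier transform of this damped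
  -- function.
  set g : ℝ → ℂ := (Set.Ioi 0).indicator fun y : ℝ =>
    Complex.exp (-(((σ + 1 : ℝ) : ℂ) * y)) * f y with hg
  have hgi : Integrable g := (integrable_indicator_iff measurableSet_Ioi).2 (hf _ (by linarith))
  have hF : FourierTransform.fourier g = 0 := by
    ext w
    rw [Real.fourier_real_eq_integral_exp_smul, Pi.zero_apply]
    have h1 := hzero (x := ((σ + 1 : ℝ) : ℂ) + (2 * Real.pi * w : ℝ) * Complex.I) (by
      simp)
    simp only [Pi.zero_apply, hΛ] at h1
    rw [← h1, ← integral_indicator measurableSet_Ioi]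
    congr 1
    ext y
    by_cases hy : y ∈ Set.Ioi (0 : ℝ)
    · rw [hg, Set.indicator_of_mem hy, Set.indicator_of_mem hy, smul_eq_mul, ← mul_assoc,
        ← Complex.exp_add]
      congr 2
      push_cast; ring
    · rw [hg, Set.indicator_of_notMem hy, Set.indicator_of_notMem hy, smul_zero]
  have hgc : ContinuousAt g x := by
    have h1 : ContinuousAt (fun y : ℝ => Complex.exp (-(((σ + 1 : ℝ) : ℂ) * y)) * f y) x :=
      (by fun_prop : Continuous fun y : ℝ =>
        Complex.exp (-(((σ + 1 : ℝ) : ℂ) * y))).continuousAt.mul hc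
    refine h1.congr ?_
    filter_upwards [Ioi_mem_nhds hx] with y hy
    rw [hg, Set.indicator_of_mem hy]
  -- The Fourier transform is 0, hence integrable, so inversion holds at the continuity point x.
  have h2 := hgi.fourierInv_fourier_eq (by rw [hF]; exact integrable_zero _ _ _) hgc
  rw [hF, hg, Set.indicator_of_mem (Set.mem_Ioi.2 hx), Real.fourierInv_eq] at h2
  simp only [Pi.zero_apply, smul_zero, integral_zero] at h2
  exact (mul_eq_zero.1 h2.symm).resolve_left (Complex.exp_ne_zero _)

/-! ### Laplace transforms of the distribution function and of Φ₂ -/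

/-- The Laplace transform of the distribution function of a nonnegative random variable. -/
theorem laplace_cdf {Ω : Type*} [MeasurableSpace Ω] (P : Measure Ω) [IsProbabilityMeasure P]
    {γ : Ω → ℝ} (hγ : AEMeasurable γ P) (h0 : ∀ᵐ ω ∂P, 0 ≤ γ ω) {t : ℝ} (ht : 0 < t) :
    IntegrableOn (fun x : ℝ => Complex.exp (-(t * x)) * ((cdf (P.map γ) x : ℝ) : ℂ)) (Set.Ioi 0) ∧
    ∫ x in Set.Ioi (0 : ℝ), Complex.exp (-(t * x)) * ((cdf (P.map γ) x : ℝ) : ℂ) =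
      complexMGF γ P (-(t : ℂ)) / t := by
  have : IsProbabilityMeasure (P.map γ) := Measure.isProbabilityMeasure_map hγ
  set ν := P.map γ with hν
  have hν0 : ∀ᵐ y ∂ν, 0 ≤ y := (ae_map_iff hγ measurableSet_Ici).2 h0
  have hexp : IntegrableOn (fun x : ℝ => Complex.exp (-(t * x))) (Set.Ioi 0) := by
    simpa using integrableOn_exp_mul_complex_Ioi (a := -(t : ℂ)) (by simpa using ht) 0
  -- F(x) is the integral over the law of γ of the indicator of y ≤ x; Fubini then leaves the
  -- integral of exp(-t x) over x ≥ y.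
  have hint : Integrable (Function.uncurry fun (x y : ℝ) =>
      Complex.exp (-(t * x)) * (Set.Ici y).indicator (fun _ => (1 : ℂ)) x)
      ((volume.restrict (Set.Ioi 0)).prod ν) := by
    refine Integrable.mono (hexp.comp_fst ν) ?_ (Filter.Eventually.of_forall fun q => ?_)
    · refine Measurable.aestronglyMeasurable ?_
      have h1 : Measurable fun q : ℝ × ℝ => (Set.Ici q.2).indicator (fun _ => (1 : ℂ)) q.1 :=
        Measurable.ite (measurableSet_le measurable_snd measurable_fst) measurable_const
          measurable_const
      exact (by fun_prop : Measurable fun q : ℝ × ℝ => Complex.exp (-(t * q.1))).mul h1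
    · simp only [Function.uncurry_def, norm_mul]
      refine mul_le_of_le_one_right (norm_nonneg _) ?_
      by_cases hq : q.1 ∈ Set.Ici q.2 <;> simp [hq]
  have hcdf (x : ℝ) : ∫ y, Complex.exp (-(t * x)) * (Set.Ici y).indicator (fun _ => (1 : ℂ)) x ∂ν =
      Complex.exp (-(t * x)) * ((cdf ν x : ℝ) : ℂ) := by
    rw [integral_const_mul, cdf_eq_real]
    congr 1
    have : (fun y : ℝ => (Set.Ici y).indicator (fun _ => (1 : ℂ)) x) =
        (Set.Iic x).indicator fun _ => (1 : ℂ) := by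
      ext y; simp [Set.indicator_apply]
    rw [this, integral_indicator measurableSet_Iic]
    simp
  refine ⟨?_, ?_⟩
  · have := hint.integral_prod_left
    simp only [Function.uncurry_apply_pair, hcdf] at this
    exact this
  · have hswap := integral_integral_swap hint
    simp_rw [hcdf] at hswap
    rw [hswap]
    have hinner : ∀ᵐ y ∂ν, ∫ x in Set.Ioi (0 : ℝ),
        Complex.exp (-(t * x)) * (Set.Ici y).indicator (fun _ => (1 : ℂ)) x =
        Complex.exp (-(t : ℂ) * y) / t := by
      filter_upwards [hν0] with y hy
      have e1 : (fun x : ℝ => Complex.exp (-(t * x)) * (Set.Ici y).indicator (fun _ => (1 : ℂ)) x) =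
          (Set.Ici y).indicator fun x : ℝ => Complex.exp (-(t : ℂ) * x) := by
        ext x; by_cases hx : x ∈ Set.Ici y <;> simp [hx]
      rw [← integral_Ici_eq_integral_Ioi, e1, setIntegral_indicator measurableSet_Ici,
        Set.inter_eq_right.2 (Set.Ici_subset_Ici.2 hy), integral_Ici_eq_integral_Ioi,
        integral_exp_mul_complex_Ioi (by simpa using ht)]
      rw [neg_div_neg_eq]
    rw [integral_congr_ae hinner, integral_div, hν,
      integral_map hγ (Continuous.aestronglyMeasurable (by fun_prop))]
    rfl

/-- Locally uniform convergence. Since Re c ≥ 1, |(c)_{|m|}| ≥ |m|! ≥ ∏ m_i!, which cancels the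
factorials from the bound on (b_i)_{m_i}; what remains is a product of exponential series. -/
lemma continuous_lauricellaPhi2 {n : ℕ} (b : Fin n → ℂ) {c : ℂ} (hc : 1 ≤ c.re) :
    Continuous (lauricellaPhi2 b c) := by
  have hsum (R : ℝ) : Summable fun m : Fin n → ℕ =>
      ‖∏ i, ((((1 + ‖b i‖) * R) ^ m i / (m i).factorial : ℝ) : ℂ)‖ := by
    have h1 (i : Fin n) : Summable fun k : ℕ =>
        ‖((((1 + ‖b i‖) * R) ^ k / k.factorial : ℝ) : ℂ)‖ := by
      simp only [Complex.norm_real]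
      exact (Real.summable_pow_div_factorial _).norm
    exact (hasSum_prod_pi _ _ (fun i => (h1 i).of_norm.hasSum) h1).2
  have hbound (R : ℝ) (m : Fin n → ℕ) (x : Fin n → ℂ) (hx : ‖x‖ ≤ R) :
      ‖(∏ i, poch (b i) (m i)) / poch c (∑ i, m i) * ∏ i, x i ^ m i / ((m i).factorial : ℂ)‖ ≤
      ‖∏ i, ((((1 + ‖b i‖) * R) ^ m i / (m i).factorial : ℝ) : ℂ)‖ := by
    have hR : 0 ≤ R := (norm_nonneg x).trans hx
    have hfac : (0 : ℝ) < ∏ i, ((m i).factorial : ℝ) :=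
      Finset.prod_pos fun i _ => by exact_mod_cast (m i).factorial_pos
    have h1 : ∏ i, ((m i).factorial : ℝ) ≤ ‖poch c (∑ i, m i)‖ := by
      refine le_trans ?_ (factorial_le_norm_poch hc _)
      exact_mod_cast factorial_prod_le_factorial_sum m
    have h2 : ‖∏ i, poch (b i) (m i)‖ ≤ ∏ i, ((1 + ‖b i‖) ^ m i * (m i).factorial) := by
      rw [norm_prod]
      exact Finset.prod_le_prod (fun i _ => norm_nonneg _) fun i _ => norm_poch_le _ _
    have h3 : ‖∏ i, x i ^ m i / ((m i).factorial : ℂ)‖ ≤ ∏ i, R ^ m i / (m i).factorial := by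
      rw [norm_prod]
      refine Finset.prod_le_prod (fun i _ => norm_nonneg _) fun i _ => ?_
      rw [norm_div, norm_pow, Complex.norm_natCast]
      have := (norm_le_pi_norm x i).trans hx
      gcongr
    have h4 : ‖∏ i, ((((1 + ‖b i‖) * R) ^ m i / (m i).factorial : ℝ) : ℂ)‖ =
        ∏ i, ((1 + ‖b i‖) * R) ^ m i / (m i).factorial := by
      rw [norm_prod]
      refine Finset.prod_congr rfl fun i _ => ?_
      rw [Complex.norm_real, Real.norm_of_nonneg (by positivity)]
    rw [h4, norm_mul, norm_div]
    calc _ ≤ (∏ i, ((1 + ‖b i‖) ^ m i * (m i).factorial)) / (∏ i, ((m i).factorial : ℝ)) *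
          ∏ i, R ^ m i / (m i).factorial := by gcongr
      _ = _ := by
        rw [Finset.prod_mul_distrib, mul_div_assoc, div_self hfac.ne', mul_one,
          ← Finset.prod_mul_distrib]
        exact Finset.prod_congr rfl fun i _ => by rw [mul_pow]; ring
  refine continuous_iff_continuousAt.2 fun x₀ => ?_
  have hball : ∀ x ∈ Metric.ball x₀ 1, ‖x‖ ≤ ‖x₀‖ + 1 := fun x hx => by
    have := norm_sub_norm_le x x₀
    rw [mem_ball_iff_norm] at hx
    linarith
  refine (continuousOn_tsum (fun m => Continuous.continuousOn (by fun_prop)) (hsum (‖x₀‖ + 1))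
    fun m x hx => hbound _ m x (hball x hx)).continuousAt (Metric.ball_mem_nhds _ one_pos)

lemma integrable_tsum_of_summable_integral_norm {α ι : Type*} [MeasurableSpace α] {μ : Measure α}
    [Countable ι] {F : ι → α → ℂ} (hF : ∀ i, Integrable (F i) μ)
    (hsum : Summable fun i => ∫ a, ‖F i a‖ ∂μ)
    (hm : AEStronglyMeasurable (fun a => ∑' i, F i a) μ) :
    Integrable (fun a => ∑' i, F i a) μ := by
  refine ⟨hm, ?_⟩
  rw [hasFiniteIntegral_iff_enorm]
  calc ∫⁻ a, ‖∑' i, F i a‖ₑ ∂μ ≤ ∫⁻ a, ∑' i, ‖F i a‖ₑ ∂μ :=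
        lintegral_mono fun a => enorm_tsum_le_tsum_enorm
    _ = ∑' i, ENNReal.ofReal (∫ a, ‖F i a‖ ∂μ) := by
        rw [lintegral_tsum fun i => (hF i).1.enorm]
        exact tsum_congr fun i => (ofReal_integral_norm_eq_lintegral_enorm (hF i)).symm
    _ < ⊤ := hsum.tsum_ofReal_lt_top

/-- The Laplace transform of `x ^ β * Φ₂(b; 1 + β; -a x)`. -/
theorem laplace_lauricellaPhi2 {n : ℕ} (a b : Fin n → ℂ) {β t : ℝ} (hβ : 0 < β) (ht : 0 < t)
    (hat : ∀ i, ‖a i‖ < t) :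
    IntegrableOn (fun x : ℝ => Complex.exp (-(t * x)) *
      ((x : ℂ) ^ (β : ℂ) * lauricellaPhi2 b (1 + β) fun i => -a i * (x : ℂ))) (Set.Ioi 0) ∧
    ∫ x in Set.Ioi (0 : ℝ), Complex.exp (-(t * x)) *
      ((x : ℂ) ^ (β : ℂ) * lauricellaPhi2 b (1 + β) fun i => -a i * (x : ℂ)) =
      Complex.Gamma (1 + β) * ((t : ℂ) ^ (-(β : ℂ)) / t) * ∏ i, (1 + a i / t) ^ (-b i) := by
  have ht0 : (t : ℂ) ≠ 0 := by exact_mod_cast ht.ne'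
  have hc : 1 ≤ (1 + (β : ℂ)).re := by simp [hβ.le]
  have hc0 : 0 < (1 + (β : ℂ)).re := by linarith
  have hcont := continuous_lauricellaPhi2 b hc
  set C : (Fin n → ℕ) → ℂ := fun m => (∏ i, poch (b i) (m i)) / poch (1 + β) (∑ i, m i) *
    ∏ i, (-a i) ^ m i / ((m i).factorial : ℂ) with hC
  -- The exponent is left as + 1 - 1 to match the integrand of the real Gamma integral.
  set r : (Fin n → ℕ) → ℝ → ℝ := fun m x =>
    x ^ (β + (∑ i, m i : ℕ) + 1 - 1) * Real.exp (-(t * x)) with hr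
  set A : ℂ := Complex.Gamma (1 + β) * ((t : ℂ) ^ (-(β : ℂ)) / t) with hA
  set T : (Fin n → ℕ) → ℂ := fun m =>
    ∏ i, poch (b i) (m i) * ((-a i / t) ^ m i / ((m i).factorial : ℂ)) with hT
  have hpos (m : Fin n → ℕ) : 0 < β + (∑ i, m i : ℕ) + 1 := by positivity
  have hri (m : Fin n → ℕ) : IntegrableOn (r m) (Set.Ioi 0) := by
    have h1 := Real.integral_rpow_mul_exp_neg_mul_Ioi (hpos m) ht
    -- A nonintegrable function has integral 0 by convention, so the positive value of the Gamma
    -- integral proves integrability.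
    refine MeasureTheory.Integrable.of_integral_ne_zero ?_
    rw [h1]
    exact (mul_pos (Real.rpow_pos_of_pos (by positivity) _) (Real.Gamma_pos_of_pos (hpos m))).ne'
  have hrv (m : Fin n → ℕ) : C m * ((∫ x in Set.Ioi (0 : ℝ), r m x : ℝ) : ℂ) = A * T m := by
    rw [hr, Real.integral_rpow_mul_exp_neg_mul_Ioi (hpos m) ht, Complex.ofReal_mul,
      ← Complex.Gamma_ofReal, Complex.ofReal_cpow (by positivity)]
    have e1 : ((β + (∑ i, m i : ℕ) + 1 : ℝ) : ℂ) = (1 + (β : ℂ)) + ((∑ i, m i : ℕ) : ℂ) := by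
      push_cast; ring
    have e2 : ((1 / t : ℝ) : ℂ) ≠ 0 := by exact_mod_cast (one_div_pos.2 ht).ne'
    have e3 : ((1 / t : ℝ) : ℂ) ^ (1 + (β : ℂ)) = (t : ℂ) ^ (-(β : ℂ)) / t := by
      rw [Complex.cpow_add _ _ e2, Complex.cpow_one]
      have : (t : ℂ).arg ≠ Real.pi := by
        rw [Complex.arg_ofReal_of_nonneg ht.le]; exact Real.pi_ne_zero.symm
      rw [one_div, Complex.ofReal_inv, Complex.inv_cpow _ _ this, Complex.cpow_neg]
      ring
    have e4 : ∏ i, (-a i / (t : ℂ)) ^ m i = (∏ i, (-a i) ^ m i) * ((1 / t : ℝ) : ℂ) ^ (∑ i, m i) := by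
      rw [← Finset.prod_pow_eq_pow_sum, ← Finset.prod_mul_distrib]
      refine Finset.prod_congr rfl fun i _ => ?_
      rw [← mul_pow]; congr 1; push_cast; ring
    rw [e1, Complex.cpow_add _ _ e2, Complex.cpow_natCast, e3, Gamma_add_natCast_eq hc0, hC, hT, hA]
    simp only [Finset.prod_mul_distrib, Finset.prod_div_distrib]
    rw [e4]
    have := poch_ne_zero hc0 (∑ i, m i)
    field_simp
  have hTs := hasSum_prod_binomial b (fun i => -a i / (t : ℂ)) fun i => by
    rw [norm_div, norm_neg, Complex.norm_real, Real.norm_of_nonneg ht.le, div_lt_one ht]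
    exact hat i
  have hFi (m : Fin n → ℕ) : Integrable (fun x : ℝ => C m * (r m x : ℂ))
      (volume.restrict (Set.Ioi 0)) := (hri m).ofReal.const_mul _
  -- As r m ≥ 0 on the half-line, the integral of the norm is the norm of the integral; summability
  -- thus reduces to that of the binomial series at -a_i/t.
  have hFn (m : Fin n → ℕ) : ∫ x in Set.Ioi (0 : ℝ), ‖C m * (r m x : ℂ)‖ = ‖A‖ * ‖T m‖ := by
    rw [← norm_mul, ← hrv, norm_mul, Complex.norm_real, Real.norm_of_nonneg
      (setIntegral_nonneg measurableSet_Ioi fun x hx =>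
        mul_nonneg (Real.rpow_nonneg (le_of_lt hx) _) (Real.exp_nonneg _)), ← integral_const_mul]
    refine setIntegral_congr_fun measurableSet_Ioi fun x hx => ?_
    simp only [norm_mul, Complex.norm_real]
    rw [Real.norm_of_nonneg (mul_nonneg (Real.rpow_nonneg (le_of_lt hx) _) (Real.exp_nonneg _))]
  have hFs : Summable fun m => ∫ x in Set.Ioi (0 : ℝ), ‖C m * (r m x : ℂ)‖ := by
    simp_rw [hFn]
    exact hTs.2.mul_left _
  have hpt : Set.EqOn (fun x : ℝ => ∑' m, C m * (r m x : ℂ)) (fun x : ℝ => Complex.exp (-(t * x)) *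
      ((x : ℂ) ^ (β : ℂ) * lauricellaPhi2 b (1 + β) fun i => -a i * (x : ℂ))) (Set.Ioi 0) := by
    intro x hx
    have hx : 0 < x := hx
    have hx0 : (x : ℂ) ≠ 0 := by exact_mod_cast hx.ne'
    simp only [lauricellaPhi2]
    rw [← mul_assoc, ← tsum_mul_left]
    refine tsum_congr fun m => ?_
    have e1 : ((r m x : ℝ) : ℂ) = Complex.exp (-(t * x)) * (x : ℂ) ^ (β : ℂ) *
        (x : ℂ) ^ (∑ i, m i) := by
      rw [hr, Complex.ofReal_mul, Complex.ofReal_cpow hx.le, add_sub_cancel_right,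
        Complex.ofReal_add, Complex.ofReal_natCast, Complex.cpow_add _ _ hx0,
        Complex.cpow_natCast, Complex.ofReal_exp]
      push_cast; ring
    have e2 : ∏ i, (-a i * (x : ℂ)) ^ m i = (∏ i, (-a i) ^ m i) * (x : ℂ) ^ (∑ i, m i) := by
      rw [← Finset.prod_pow_eq_pow_sum, ← Finset.prod_mul_distrib]
      exact Finset.prod_congr rfl fun i _ => by rw [← mul_pow]
    rw [e1, hC]
    simp only [Finset.prod_div_distrib]
    rw [e2]
    ring
  have hG : Continuous fun x : ℝ => Complex.exp (-(t * x)) *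
      ((x : ℂ) ^ (β : ℂ) * lauricellaPhi2 b (1 + β) fun i => -a i * (x : ℂ)) := by
    have h1 : Continuous fun x : ℝ => (x : ℂ) ^ (β : ℂ) :=
      Complex.continuous_ofReal_cpow_const (by simpa using hβ)
    have h2 : Continuous fun x : ℝ => lauricellaPhi2 b (1 + β) fun i => -a i * (x : ℂ) :=
      hcont.comp (by fun_prop)
    fun_prop
  have hm : AEStronglyMeasurable (fun x : ℝ => ∑' m, C m * (r m x : ℂ))
      (volume.restrict (Set.Ioi 0)) :=
    hG.aestronglyMeasurable.congr
      ((ae_restrict_iff' measurableSet_Ioi).2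
        (Filter.Eventually.of_forall fun x hx => (hpt hx).symm))
  refine ⟨IntegrableOn.congr_fun (integrable_tsum_of_summable_integral_norm hFi hFs hm) hpt
    measurableSet_Ioi, ?_⟩
  rw [← setIntegral_congr_fun measurableSet_Ioi hpt]
  refine (hasSum_integral_of_summable_integral_norm hFi hFs).unique ?_
  convert! hTs.1.mul_left A using 1
  · ext m
    rw [integral_const_mul, integral_complex_ofReal, hrv]
  · simp only [neg_div, sub_neg_eq_add]

/-! ### The distribution function of a posynomial variable -/

/-- A right-continuous function which agrees with a continuous one at its points of continuity in
`(0, ∞)`, where it has at most countably many discontinuities, agrees with it on `[0, ∞)`. -/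
lemma eq_of_eq_continuousAt {F G : ℝ → ℂ} (hF : ∀ x, ContinuousWithinAt F (Set.Ici x) x)
    (hcount : {x | ¬ContinuousAt F x}.Countable) (hG : Continuous G)
    (heq : ∀ x, 0 < x → ContinuousAt F x → F x = G x) {x : ℝ} (hx : 0 ≤ x) : F x = G x := by
  -- Continuity points are dense, hence accumulate at x from the right, where both functions
  -- converge to their values at x.
  refine tendsto_nhds_unique_of_frequently_eq (l := nhdsWithin x (Set.Ioi x))
    (((hF x).mono Set.Ioi_subset_Ici_self).tendsto) (hG.continuousAt.tendsto.mono_left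
      nhdsWithin_le_nhds) ?_
  rw [Filter.frequently_iff]
  intro U hU
  obtain ⟨u, hu, hsub⟩ := mem_nhdsGT_iff_exists_Ioo_subset.1 hU
  obtain ⟨y, hy, hy'⟩ := (hcount.dense_compl ℝ).exists_between hu
  exact ⟨y, hsub hy', heq y (hx.trans_lt hy'.1) (not_not.1 hy)⟩

theorem IsPosynomial.cdf_eq {Ω : Type*} [MeasurableSpace Ω] {P : Measure Ω}
    [IsProbabilityMeasure P] {γ : Ω → ℝ} (hγ : AEMeasurable γ P)
    {K : ℕ} {n : Fin K → ℕ} {a b : (k : Fin K) → Fin (n k) → ℂ} {c : Fin K → ℂ}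
    (h : IsPosynomial γ P a b c) {x : ℝ} (hx : 0 ≤ x) :
    ((cdf (P.map γ) x : ℝ) : ℂ) =
      ∑ k, c k * ((∏ i, a k i ^ b k i) / Complex.Gamma (1 + ∑ i, b k i)) *
        (x : ℂ) ^ (∑ i, b k i) *
        lauricellaPhi2 (b k) (1 + ∑ i, b k i) (fun i => -a k i * (x : ℂ)) := by
  obtain ⟨β, hβ⟩ : ∃ β : Fin K → ℝ, ∀ k, ∑ i, b k i = (β k : ℂ) :=
    ⟨fun k => (∑ i, b k i).re, fun k => by
      apply Complex.ext
      · simp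
      · rw [(h.sum_pos k).2, Complex.ofReal_im]⟩
  have hβ0 (k : Fin K) : 0 < β k := by simpa [hβ] using (h.sum_pos k).1
  simp_rw [hβ]
  set G : ℝ → ℂ := fun x => ∑ k, c k * ((∏ i, a k i ^ b k i) / Complex.Gamma (1 + β k)) *
    (x : ℂ) ^ (β k : ℂ) * lauricellaPhi2 (b k) (1 + β k) (fun i => -a k i * (x : ℂ)) with hGdef
  have hG : Continuous G := by
    refine continuous_finsetSum _ fun k _ => ?_
    have h1 : Continuous fun x : ℝ => (x : ℂ) ^ (β k : ℂ) :=
      Complex.continuous_ofReal_cpow_const (by simpa using hβ0 k)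
    have h2 : Continuous fun x : ℝ => lauricellaPhi2 (b k) (1 + β k) fun i => -a k i * (x : ℂ) :=
      (continuous_lauricellaPhi2 (b k) (by simp [(hβ0 k).le])).comp (by fun_prop)
    fun_prop
  -- Any t > σ exceeds every |a k i|, so all the binomial series in a k i / t converge at once.
  set σ : ℝ := ∑ k, ∑ i, ‖a k i‖ with hσ
  have hσ0 : 0 ≤ σ := Finset.sum_nonneg fun k _ => Finset.sum_nonneg fun i _ => norm_nonneg _
  have ha (k : Fin K) (i : Fin (n k)) : ‖a k i‖ ≤ σ :=
    (Finset.single_le_sum (f := fun i => ‖a k i‖) (fun i _ => norm_nonneg _)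
      (Finset.mem_univ i)).trans (Finset.single_le_sum (f := fun k => ∑ i, ‖a k i‖)
        (fun k _ => Finset.sum_nonneg fun i _ => norm_nonneg _) (Finset.mem_univ k))
  have hGterm (t x : ℝ) : Complex.exp (-(t * x)) * G x =
      ∑ k, c k * ((∏ i, a k i ^ b k i) / Complex.Gamma (1 + β k)) *
        (Complex.exp (-(t * x)) * ((x : ℂ) ^ (β k : ℂ) *
          lauricellaPhi2 (b k) (1 + β k) (fun i => -a k i * (x : ℂ)))) := by
    rw [hGdef, Finset.mul_sum]
    exact Finset.sum_congr rfl fun k _ => by ring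
  have hL (t : ℝ) (ht : σ < t) (k : Fin K) := laplace_lauricellaPhi2 (a k) (b k) (hβ0 k)
    (hσ0.trans_lt ht) fun i => (ha k i).trans_lt ht
  have hGint (t : ℝ) (ht : σ < t) :
      IntegrableOn (fun x : ℝ => Complex.exp (-(t * x)) * G x) (Set.Ioi 0) := by
    simp_rw [hGterm]
    exact integrable_finsetSum _ fun k _ => (hL t ht k).1.const_mul _
  have hGlap (t : ℝ) (ht : σ < t) : ∫ x in Set.Ioi (0 : ℝ), Complex.exp (-(t * x)) * G x =
      complexMGF γ P (-(t : ℂ)) / t := by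
    have ht0 : 0 < t := hσ0.trans_lt ht
    have ht0' : (t : ℂ) ≠ 0 := by exact_mod_cast ht0.ne'
    simp_rw [hGterm]
    rw [integral_finsetSum _ fun k _ => (hL t ht k).1.const_mul _, h.mgf_eq _ (by simp [ht0.le]),
      Finset.sum_div]
    refine Finset.sum_congr rfl fun k _ => ?_
    have hg : Complex.Gamma (1 + β k) ≠ 0 :=
      Complex.Gamma_ne_zero_of_re_pos (by simp; linarith [hβ0 k])
    have e1 (i : Fin (n k)) : 1 - -(t : ℂ) / a k i = 1 + t / a k i := by ring
    simp only [e1]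
    rw [integral_const_mul, (hL t ht k).2, prod_one_add_div_cpow (h.re_pos k) ht0, hβ]
    field_simp
  set F : ℝ → ℂ := fun x => ((cdf (P.map γ) x : ℝ) : ℂ) with hF
  have hcF (x : ℝ) (hx : ContinuousAt (cdf (P.map γ)) x) : ContinuousAt F x :=
    Complex.continuous_ofReal.continuousAt.comp hx
  refine eq_of_eq_continuousAt (F := F) (G := G) (fun x => ?_) ?_ hG (fun x hx hc => ?_) hx
  · exact Complex.continuous_ofReal.continuousAt.comp_continuousWithinAt
      ((cdf (P.map γ)).right_continuous x)
  · exact (monotone_cdf (P.map γ)).countable_not_continuousAt.mono fun x hx hc => hx (hcF x hc)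
  · refine sub_eq_zero.1 (eq_zero_of_laplace_eq_zero (f := fun x => F x - G x) (σ := σ)
      (fun t ht => ?_) (fun t ht => ?_) hx (hc.sub hG.continuousAt)) <;> simp_rw [mul_sub]
    · exact (laplace_cdf P hγ h.nonneg (hσ0.trans_lt ht)).1.sub (hGint t ht)
    · have hcdf := laplace_cdf P hγ h.nonneg (hσ0.trans_lt ht)
      rw [integral_sub hcdf.1 (hGint t ht), hcdf.2, hGlap t ht, sub_self]

theorem corollary1 {Ω : Type*} [MeasurableSpace Ω] (P : Measure Ω) [IsProbabilityMeasure P]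
    (γ : Ω → ℝ) (hγ : AEMeasurable γ P)
    (K : ℕ) (n : Fin K → ℕ) (a b : (k : Fin K) → Fin (n k) → ℂ) (c : Fin K → ℂ)
    (h : IsPosynomial γ P a b c) :
    (∀ x : ℝ, 0 ≤ x →
      ((cdf (P.map γ) x : ℝ) : ℂ) =
        ∑ k, c k * ((∏ i, a k i ^ b k i) / Complex.Gamma (1 + ∑ i, b k i)) *
          (x : ℂ) ^ (∑ i, b k i) *
          lauricellaPhi2 (b k) (1 + ∑ i, b k i) (fun i => -a k i * (x : ℂ))) ∧
    (∀ p : ℝ, 0 < p →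
      ((gaussianQTransform γ P p : ℝ) : ℂ) =
        1 / (2 * ((√Real.pi : ℝ) : ℂ)) *
          ∑ k, c k * (∏ i, a k i ^ b k i) *
            (Complex.Gamma (1 / 2 + ∑ i, b k i) / Complex.Gamma (1 + ∑ i, b k i)) *
            (2 / (p : ℂ)) ^ (∑ i, b k i) *
            lauricellaFD (1 / 2 + ∑ i, b k i) (b k) (1 + ∑ i, b k i)
              (fun i => -(2 * a k i) / (p : ℂ))) := by
  exact ⟨fun x hx => h.cdf_eq hγ hx, fun p hp => h.gaussianQTransform_eq hγ hp⟩
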